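/- Let $d\ge 1$, $m,n\ge 0$, $p=m+n$, and let $\eta(x)=(\eta_1(x),\dots,\eta_{p}(x))$, $x\in\mathbb{R}^d$, be a measurable homogeneous isotropic Gaussian vector random field with independent components, zero mean and unit variances, such that for $x\ne y$ $$\mathbf{Cov}(\eta_j(x),\eta_j(y))=\|x-y\|^{-e_j}L_j(\|x-y\|),\qquad j=1,\dots,p,$$ where $e_i=\beta_i>d$ for $i=1,\dots,m$ (weakly dependent components), $e_j=\alpha_j\in(0,d)$ for $j=m+1,\dots,m+n$ (strongly dependent components), and $L_1,\dots,L_p:(0,\infty)\to(0,\infty)$ are measurable functions slowly varying at infinity. Let $\Delta\subset\mathbb{R}^d$ be a Jordan-measurable compact connected set of positive Lebesgue measure containing the origin in its interior, and $\Delta(r)=r\Delta$. Let $\phi_p$ be the standard Gaussian density on $\mathbb{R}^p$ and $G\in L_2(\mathbb{R}^p,\phi_p(w)\,dw)$. For $v=(k_1,\dots,k_p)\in\mathbb{Z}_{\ge0}^p$ put $|v|=\sum_j k_j$, $v!=\prod_j k_j!$, $e_v(w)=\prod_j H_{k_j}(w_j)$, where $H_k$ are the (probabilists') Hermite polynomials,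 and $C_v=\int_{\mathbb{R}^p} G(w)e_v(w)\phi_p(w)\,dw$. Assume that $C_0=0$ and that $G$ has Hermite rank $\kappa\ge1$, i.e. $\kappa$ is the smallest integer $k\geq 1$ such that $C_v\neq0$ for some $v$ with $|v|=k$. Define $$K_r=\int_{\Delta(r)}G(\eta(x))\,dx,\qquad N_+=\{v:\ |v|\ge\kappa,\ C_v\ne0\},\qquad \tilde\gamma=\min_{v\in N_+}\sum_{j=1}^{p}e_jk_j,$$ $$\tilde N_l^*=\Big\{v\in N_+:\ |v|=l,\ \sum_{j=1}^{p} e_jk_j=\tilde\gamma\Big\},\qquad \tilde{\mathcal L}_+=\{l\ge\kappa:\ \tilde N_l^*\ne\varnothing\},\qquad \tilde K^*_{r,l}=\sum_{v\in\tilde N_l^*}\frac{C_v}{v!}\int_{\Delta(r)}e_v(\eta(x))\,dx .$$ The set $\tilde{\mathcal L}_+$ is finite. Suppose $\tilde\gamma<d$. If, as $r\to\infty$, a limit distribution exists for at least one of the random variables $$\frac{K_r}{\sqrt{\mathbf{Var}(K_r)}}\qquad\text{and}\qquad \frac{\sum_{l\in\tilde{\mathcal L}_+}\tilde K^*_{r,l}}{\sqrt{\mathbf{Var}\big(\sum_{l\in\tilde{\mathcal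 L}_+}\tilde K^*_{r,l}\big)}},$$ then the limit distribution of the other random variable exists as well, and the two limit distributions coincide. -/

import Mathlib

open MeasureTheory ProbabilityTheory Filter Topology
open scoped Pointwise

noncomputable section

namespace HermiteReduction

/-- A measurable function `L : (0,∞) → (0,∞)` (given as a function on `ℝ` of which only the values on
`(0,∞)` matter) that is slowly varying at infinity. -/
structure SlowlyVarying (L : ℝ → ℝ) : Prop where
  measurable : Measurable fun t : Set.Ioi (0 : ℝ) ↦ L t
  pos : ∀ t, 0 < t → 0 < L t
  tendsto : ∀ t, 0 < t → Tendsto (fun r ↦ L (t * r) / L r) atTop (𝓝 1)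

/-- The observation window: a Jordan-measurable compact connected set of positive Lebesgue measure
with the origin in its interior. -/
structure IsWindow {d : ℕ} (Δ : Set (EuclideanSpace ℝ (Fin d))) : Prop where
  isCompact : IsCompact Δ
  isConnected : IsConnected Δ
  jordan : volume (frontier Δ) = 0
  volume_pos : 0 < volume Δ
  zero_mem : (0 : EuclideanSpace ℝ (Fin d)) ∈ interior Δ

/-- A measurable, centred, unit variance Gaussian vector random field on `ℝ^d` with components indexed by
`ι`, whose components are independent, homogeneous and isotropic, the `j`-th one having the
covariance function `ρ ↦ ρ ^ (-e j) * L j ρ`, `ρ > 0`. -/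
structure IsGaussianVectorField {d : ℕ} {ι Ω : Type*} [Fintype ι] [MeasurableSpace Ω]
    (P : Measure Ω) (η : ι → EuclideanSpace ℝ (Fin d) → Ω → ℝ) (e : ι → ℝ) (L : ι → ℝ → ℝ) :
    Prop where
  measurable : ∀ j, Measurable (Function.uncurry (η j))
  gaussian : IsGaussianProcess
    (fun p : ι × EuclideanSpace ℝ (Fin d) ↦ η p.1 p.2) P
  indep : iIndepFun (fun j ω ↦ (fun x : EuclideanSpace ℝ (Fin d) ↦ η j x ω)) P
  mean_zero : ∀ j x, ∫ ω, η j x ω ∂P = 0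
  variance_one : ∀ j x, variance (η j x) P = 1
  covariance_eq : ∀ j x y, x ≠ y →
    covariance (η j x) (η j y) P = ‖x - y‖ ^ (-e j) * L j ‖x - y‖

section Hermite

variable {ι : Type*} [Fintype ι]

/-- The product `e_v(w) = ∏ H_{k_j}(w_j)` of probabilists' Hermite polynomials, `v = (k_j)`. -/
def hermiteProd (v : ι → ℕ) (w : ι → ℝ) : ℝ :=
  ∏ j, Polynomial.aeval (w j) (Polynomial.hermite (v j))

/-- The standard Gaussian measure `φ(‖w‖) dw` on `ℝ^ι`. -/
def stdGaussianMeasure (ι : Type*) [Fintype ι] : Measure (ι → ℝ) :=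
  Measure.pi fun _ ↦ gaussianReal 0 1

/-- The Hermite coefficient `C_v = ∫ G(w) e_v(w) φ(‖w‖) dw`. -/
def hermiteCoeff (G : (ι → ℝ) → ℝ) (v : ι → ℕ) : ℝ :=
  ∫ w, G w * hermiteProd v w ∂(stdGaussianMeasure ι)

/-- `κ ≥ 1` is the Hermite rank of `G`. -/
structure IsHermiteRank (G : (ι → ℝ) → ℝ) (κ : ℕ) : Prop where
  one_le : 1 ≤ κ
  coeff_eq_zero : ∀ v : ι → ℕ, 1 ≤ ∑ j, v j → ∑ j, v j < κ → hermiteCoeff G v = 0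
  exists_coeff_ne_zero : ∃ v : ι → ℕ, ∑ j, v j = κ ∧ hermiteCoeff G v ≠ 0

/-- `N₊`: multi-indices of order at least `κ` with nonzero Hermite coefficient. -/
def Nplus (G : (ι → ℝ) → ℝ) (κ : ℕ) : Set (ι → ℕ) :=
  {v | κ ≤ ∑ j, v j ∧ hermiteCoeff G v ≠ 0}

/-- The decay exponent `∑ e_j k_j` of the covariance of `e_v(η(x))`. -/
def exponentSum (e : ι → ℝ) (v : ι → ℕ) : ℝ := ∑ j, e j * (v j : ℝ)

open Classical in
/-- `Ñ*_l`: the multi-indices `v ∈ N₊` of order `l` with `∑ e_j k_j = γ`. -/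
def Nstar (G : (ι → ℝ) → ℝ) (κ : ℕ) (e : ι → ℝ) (γ : ℝ) (l : ℕ) : Finset (ι → ℕ) :=
  (Finset.piAntidiag Finset.univ l).filter fun v ↦ v ∈ Nplus G κ ∧ exponentSum e v = γ

/-- `L̃₊`: the levels `l ≥ κ` at which `Ñ*_l` is nonempty. -/
def Lplus (G : (ι → ℝ) → ℝ) (κ : ℕ) (e : ι → ℝ) (γ : ℝ) : Set ℕ :=
  {l | κ ≤ l ∧ (Nstar G κ e γ l).Nonempty}

theorem mem_Nstar {G : (ι → ℝ) → ℝ} {κ : ℕ} {e : ι → ℝ} {γ : ℝ} {l : ℕ} {v : ι → ℕ} :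
    v ∈ Nstar G κ e γ l ↔ ∑ j, v j = l ∧ v ∈ Nplus G κ ∧ exponentSum e v = γ := by
  classical
  simp [Nstar]

/-- For positive exponents the set `L̃₊` is finite, so that finite sums over it make sense. -/
theorem Lplus_finite (G : (ι → ℝ) → ℝ) (κ : ℕ) (e : ι → ℝ) (γ : ℝ) (he : ∀ j, 0 < e j) :
    (Lplus G κ e γ).Finite := by
  obtain ⟨c, hc, hce⟩ : ∃ c : ℝ, 0 < c ∧ ∀ j, c ≤ e j := by
    rcases isEmpty_or_nonempty ι with h | h
    · exact ⟨1, one_pos, fun j ↦ (h.false j).elim⟩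
    · obtain ⟨j, hj⟩ := Finite.exists_min e
      exact ⟨e j, he j, hj⟩
  refine (Set.finite_Iic ⌊γ / c⌋₊).subset ?_
  rintro l ⟨-, v, hv⟩
  obtain ⟨rfl, -, hv⟩ := mem_Nstar.1 hv
  refine Nat.le_floor ?_
  rw [le_div_iff₀ hc, ← hv, exponentSum, Nat.cast_sum, Finset.sum_mul]
  refine Finset.sum_le_sum fun j _ ↦ ?_
  rw [mul_comm]
  exact mul_le_mul_of_nonneg_right (hce j) (Nat.cast_nonneg _)

variable {d : ℕ} {Ω : Type*}

/-- `∫_{Δ(r)} F(η(x)) dx` with `Δ(r) = r Δ`, as a function of `ω`. -/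
def windowIntegral (Δ : Set (EuclideanSpace ℝ (Fin d)))
    (η : ι → EuclideanSpace ℝ (Fin d) → Ω → ℝ) (F : (ι → ℝ) → ℝ) (r : ℝ) (ω : Ω) : ℝ :=
  ∫ x in r • Δ, F (fun j ↦ η j x ω)

/-- `K̃*_{r,l} = ∑_{v ∈ Ñ*_l} (C_v / v!) ∫_{Δ(r)} e_v(η(x)) dx`. -/
def Kstar (Δ : Set (EuclideanSpace ℝ (Fin d))) (η : ι → EuclideanSpace ℝ (Fin d) → Ω → ℝ)
    (G : (ι → ℝ) → ℝ) (κ : ℕ) (e : ι → ℝ) (γ : ℝ) (l : ℕ) (r : ℝ) (ω : Ω) : ℝ :=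
  ∑ v ∈ Nstar G κ e γ l,
    hermiteCoeff G v / (∏ j, ((v j).factorial : ℝ)) * windowIntegral Δ η (hermiteProd v) r ω

/-- `∑_{l ∈ L̃₊} K̃*_{r,l}`. -/
def KstarSum (Δ : Set (EuclideanSpace ℝ (Fin d))) (η : ι → EuclideanSpace ℝ (Fin d) → Ω → ℝ)
    (G : (ι → ℝ) → ℝ) (κ : ℕ) (e : ι → ℝ) (γ : ℝ) (r : ℝ) (ω : Ω) : ℝ :=
  ∑ᶠ l ∈ Lplus G κ e γ, Kstar Δ η G κ e γ l r ω

end Hermite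

/-- As `r → ∞`, the normalized variables `X_r / √Var X_r` converge in distribution to the law `μ`. -/
def NormalizedLimit {Ω : Type*} [MeasurableSpace Ω] (P : Measure Ω) [IsProbabilityMeasure P]
    (X : ℝ → Ω → ℝ) (μ : Measure ℝ) [IsProbabilityMeasure μ] : Prop :=
  TendstoInDistribution (fun r ω ↦ X r ω / √(variance (X r) P)) atTop (id : ℝ → ℝ)
    (fun _ ↦ P) μ

end HermiteReduction

end

/-!
For an `L²` function `F`, the orthogonality of the Hermite polynomials gives
`E (∫_{Δ(r)} F(η(x)) dx)² = ∑_v C_v² / v! * ∫∫_{Δ(r) × Δ(r)} R_v`, where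
`R_v(x, y) = ∏ R_j(x, y) ^ k_j` is regularly varying in `‖x - y‖` with exponent `-∑ e_j k_j`.
If `∑ e_j k_j < d` for `v₀`, its covariance integral outgrows the volume of `Δ(r)`, which absorbs
the pairs at bounded distance, while at large distances `R_v = o(R_{v₀})` for every `v` with a
larger exponent. As `0 ≤ R_v ≤ R_u` for `u ≤ v`, Dickson's lemma makes this domination uniform
in `v`, so the terms of larger exponent are negligible in `L²` against those of exponent `γ`. Two
centred families whose difference is negligible in `L²` have the same normalized limits.
-/

namespace HermiteReduction

section SlowVariation

variable {h : ℝ → ℝ} {ε : ℝ}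

theorem tendsto_volume_setOf_le_abs_sub (hm : Measurable h)
    (hh : ∀ u, Tendsto (fun x ↦ h (x + u) - h x) atTop (𝓝 0)) (hε : 0 < ε) (a b : ℝ) :
    Tendsto (fun x ↦ volume (Set.Icc a b ∩ {u | ε ≤ |h (x + u) - h x|})) atTop (𝓝 0) := by
  have hmeas (x : ℝ) : MeasurableSet (Set.Icc a b ∩ {u | ε ≤ |h (x + u) - h x|}) :=
    measurableSet_Icc.inter <|
      measurableSet_le measurable_const ((hm.comp (measurable_const_add x)).sub_const _).abs
  rw [← measure_empty (μ := (volume : Measure ℝ))]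
  refine tendsto_measure_of_tendsto_indicator (A := ∅) atTop hmeas measurableSet_Icc (by simp)
    (.of_forall fun x ↦ Set.inter_subset_left) fun u ↦ ?_
  have hu : Tendsto (fun x ↦ |h (x + u) - h x|) atTop (𝓝 0) := by simpa using (hh u).abs
  filter_upwards [hu.eventually_lt_const hε] with x hx
  simp only [Set.mem_inter_iff, Set.mem_ofPred_eq, Set.mem_empty_iff_false, iff_false, not_and,
    not_le]
  exact fun _ ↦ hx

theorem eventually_forall_abs_sub_lt (hm : Measurable h)
    (hh : ∀ u, Tendsto (fun x ↦ h (x + u) - h x) atTop (𝓝 0)) (hε : 0 < ε) :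
    ∀ᶠ x in atTop, ∀ u ∈ Set.Icc (0 : ℝ) 1, |h (x + u) - h x| < ε := by
  set bad : ℝ → Set ℝ := fun x ↦ Set.Icc 0 2 ∩ {t | ε / 2 ≤ |h (x + t) - h x|}
  obtain ⟨X, hX⟩ := eventually_atTop.1 <|
    (tendsto_volume_setOf_le_abs_sub hm hh (half_pos hε) 0 2).eventually_lt_const
      (u := ENNReal.ofReal (1 / 4)) (by simp)
  filter_upwards [eventually_ge_atTop X] with x hx u hu
  set shifted : Set ℝ := (fun t ↦ t - u) ⁻¹' bad (x + u)
  have hshifted : volume shifted = volume (bad (x + u)) := by simp [shifted, sub_eq_add_neg]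
  -- The exceptional sets of `x` and of `x + u` are too small to cover `[1, 2]`: compare both
  -- `h x` and `h (x + u)` with `h (x + t)` at a point `t` outside of them.
  obtain ⟨t, ht, htn⟩ : ∃ t ∈ Set.Icc (1 : ℝ) 2, t ∉ bad x ∪ shifted := by
    by_contra! hcon
    have hcover : volume (Set.Icc (1 : ℝ) 2) < ENNReal.ofReal (1 / 4) + ENNReal.ofReal (1 / 4) :=
      calc volume (Set.Icc (1 : ℝ) 2) ≤ volume (bad x) + volume shifted :=
            (measure_mono hcon).trans (measure_union_le _ _)
        _ < _ := by
            rw [hshifted]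
            exact ENNReal.add_lt_add (hX x hx) (hX (x + u) (by linarith [hu.1]))
    rw [Real.volume_Icc, ← ENNReal.ofReal_add (by norm_num) (by norm_num),
      ENNReal.ofReal_lt_ofReal_iff (by norm_num)] at hcover
    norm_num at hcover
  simp only [Set.mem_union, not_or, bad, Set.mem_inter_iff, Set.mem_ofPred_eq, not_and, not_le,
    shifted, Set.mem_preimage] at htn
  have hx_t := htn.1 ⟨by linarith [ht.1], ht.2⟩
  have hxu_t := htn.2 ⟨by linarith [ht.1, hu.2], by linarith [ht.2, hu.1]⟩
  rw [show x + u + (t - u) = x + t by ring] at hxu_t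
  rw [abs_lt] at *
  constructor <;> linarith [hx_t.1, hx_t.2, hxu_t.1, hxu_t.2]

theorem exists_forall_sub_mul_le (hm : Measurable h)
    (hh : ∀ u, Tendsto (fun x ↦ h (x + u) - h x) atTop (𝓝 0)) (hε : 0 < ε) :
    ∃ c : ℝ, ∀ᶠ x in atTop, c - ε * x ≤ h x := by
  obtain ⟨X, hX⟩ := eventually_atTop.1 (eventually_forall_abs_sub_lt hm hh hε)
  have step (k : ℕ) : ∀ u ∈ Set.Icc (0 : ℝ) 1, h X - ε * (k + 1) ≤ h (X + k + u) := by
    induction k with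
    | zero =>
      intro u hu
      have := (abs_lt.1 (hX X le_rfl u hu)).1
      simp only [Nat.cast_zero, zero_add, mul_one, add_zero]
      linarith
    | succ k ih =>
      intro u hu
      have := (abs_lt.1 (hX (X + k + u) (by linarith [hu.1, k.cast_nonneg (α := ℝ)]) 1
        (by simp))).1
      push_cast
      rw [show X + (k + 1 : ℝ) + u = X + k + u + 1 by ring]
      linarith [ih u hu]
  refine ⟨h X - ε * (1 - X), ?_⟩
  filter_upwards [eventually_ge_atTop X] with x hx
  have hfloor := Nat.floor_le (sub_nonneg.2 hx)
  have hx' := step ⌊x - X⌋₊ (x - X - ⌊x - X⌋₊)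
    ⟨by linarith, by linarith [Nat.lt_floor_add_one (x - X)]⟩
  rw [show X + (⌊x - X⌋₊ : ℝ) + (x - X - ⌊x - X⌋₊) = x by ring] at hx'
  nlinarith

namespace SlowlyVarying

variable {L M : ℝ → ℝ}

theorem tendsto_log_comp_exp_add_sub (hL : SlowlyVarying L) (u : ℝ) :
    Tendsto (fun x ↦ Real.log (L (Real.exp (x + u))) - Real.log (L (Real.exp x))) atTop (𝓝 0) := by
  have hlog := (Real.continuousAt_log one_ne_zero).tendsto.comp
    ((hL.tendsto (Real.exp u) (Real.exp_pos u)).comp Real.tendsto_exp_atTop)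
  rw [Real.log_one] at hlog
  refine hlog.congr fun x ↦ ?_
  simp only [Function.comp]
  rw [← Real.exp_add, Real.log_div (hL.pos _ (Real.exp_pos _)).ne'
    (hL.pos _ (Real.exp_pos _)).ne', add_comm u x]

theorem tendsto_rpow_mul_atTop (hL : SlowlyVarying L) (hε : 0 < ε) :
    Tendsto (fun r ↦ r ^ ε * L r) atTop atTop := by
  have hm : Measurable fun x ↦ Real.log (L (Real.exp x)) :=
    Real.measurable_log.comp <| hL.measurable.comp <|
      Real.measurable_exp.subtype_mk (h := fun x ↦ Real.exp_pos x)
  obtain ⟨c, hc⟩ := exists_forall_sub_mul_le hm hL.tendsto_log_comp_exp_add_sub (half_pos hε)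
  have hlog : Tendsto (fun x ↦ ε * x + Real.log (L (Real.exp x))) atTop atTop := by
    refine tendsto_atTop_mono' _ ?_ (tendsto_atTop_add_const_left _ c
      (tendsto_id.const_mul_atTop (half_pos hε)))
    filter_upwards [hc] with x hx
    simp only [id]
    linarith
  refine (Real.tendsto_exp_atTop.comp (hlog.comp Real.tendsto_log_atTop)).congr' ?_
  filter_upwards [eventually_gt_atTop 0] with r hr
  simp only [Function.comp]
  rw [Real.exp_add, Real.exp_log hr, Real.exp_log (hL.pos r hr), Real.rpow_def_of_pos hr,
    mul_comm ε]

theorem one : SlowlyVarying fun _ ↦ 1 :=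
  ⟨measurable_const, fun _ _ ↦ one_pos, fun _ _ ↦ by simp⟩

theorem mul (hL : SlowlyVarying L) (hM : SlowlyVarying M) : SlowlyVarying fun t ↦ L t * M t where
  measurable := hL.measurable.mul hM.measurable
  pos t ht := mul_pos (hL.pos t ht) (hM.pos t ht)
  tendsto t ht := by
    simpa only [div_mul_div_comm, one_mul] using (hL.tendsto t ht).mul (hM.tendsto t ht)

theorem inv (hL : SlowlyVarying L) : SlowlyVarying fun t ↦ (L t)⁻¹ where
  measurable := hL.measurable.inv
  pos t ht := inv_pos.2 (hL.pos t ht)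
  tendsto t ht := by
    simpa only [inv_div, div_eq_mul_inv, mul_inv_rev, inv_inv, inv_one, mul_comm]
      using (hL.tendsto t ht).inv₀ one_ne_zero

theorem pow (hL : SlowlyVarying L) (k : ℕ) : SlowlyVarying fun t ↦ L t ^ k := by
  induction k with
  | zero => simpa using one
  | succ k ih => simpa only [pow_succ] using ih.mul hL

theorem prod {ι : Type*} {L : ι → ℝ → ℝ} (s : Finset ι) (hL : ∀ j ∈ s, SlowlyVarying (L j)) :
    SlowlyVarying fun t ↦ ∏ j ∈ s, L j t := by
  classical
  induction s using Finset.induction_on with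
  | empty => simpa using one
  | insert a s ha ih =>
    simp only [Finset.prod_insert ha]
    rw [Finset.forall_mem_insert] at hL
    exact hL.1.mul (ih hL.2)

end SlowlyVarying

end SlowVariation

section Moments

open scoped NNReal ENNReal

variable {Ω : Type*} [MeasurableSpace Ω] {P : Measure Ω} {X Y : Ω → ℝ}

/-- `X` has absolute moments of all finite orders; a class of random variables closed under sums and
products. -/
def HasFiniteMoments (X : Ω → ℝ) (P : Measure Ω) : Prop := ∀ p : ℝ≥0, MemLp X p P

namespace HasFiniteMoments

theorem memLp_two (hX : HasFiniteMoments X P) : MemLp X 2 P := by simpa using hX 2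

theorem integrable (hX : HasFiniteMoments X P) : Integrable X P :=
  memLp_one_iff_integrable.1 (by simpa using hX 1)

theorem const [IsFiniteMeasure P] (c : ℝ) : HasFiniteMoments (fun _ : Ω ↦ c) P :=
  fun _ ↦ memLp_const c

theorem const_mul (hX : HasFiniteMoments X P) (c : ℝ) : HasFiniteMoments (fun ω ↦ c * X ω) P :=
  fun p ↦ (hX p).const_mul c

theorem add (hX : HasFiniteMoments X P) (hY : HasFiniteMoments Y P) :
    HasFiniteMoments (fun ω ↦ X ω + Y ω) P :=
  fun p ↦ (hX p).add (hY p)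

theorem mul (hX : HasFiniteMoments X P) (hY : HasFiniteMoments Y P) :
    HasFiniteMoments (fun ω ↦ X ω * Y ω) P := fun p ↦ by
  have : ENNReal.HolderTriple ((2 * p : ℝ≥0) : ℝ≥0∞) ((2 * p : ℝ≥0) : ℝ≥0∞) p := by
    constructor
    push_cast
    rw [ENNReal.mul_inv (by simp) (by simp), ← add_mul, ENNReal.inv_two_add_inv_two, one_mul]
  exact (hY (2 * p)).mul (hX (2 * p))

theorem pow [IsFiniteMeasure P] (hX : HasFiniteMoments X P) (n : ℕ) :
    HasFiniteMoments (fun ω ↦ X ω ^ n) P := by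
  induction n with
  | zero => simpa using const (P := P) 1
  | succ n ih => simpa only [pow_succ] using ih.mul hX

theorem prod {ι : Type*} [IsFiniteMeasure P] {X : ι → Ω → ℝ} (s : Finset ι)
    (hX : ∀ j ∈ s, HasFiniteMoments (X j) P) : HasFiniteMoments (fun ω ↦ ∏ j ∈ s, X j ω) P := by
  classical
  induction s using Finset.induction_on with
  | empty => simpa using const (P := P) 1
  | insert a s ha ih =>
    rw [Finset.forall_mem_insert] at hX
    simpa only [Finset.prod_insert ha] using hX.1.mul (ih hX.2)

theorem eval [IsFiniteMeasure P] (hX : HasFiniteMoments X P) (f : Polynomial ℝ) :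
    HasFiniteMoments (fun ω ↦ f.eval (X ω)) P := by
  induction f using Polynomial.induction_on' with
  | add f g hf hg => simpa only [Polynomial.eval_add] using hf.add hg
  | monomial n a => simpa only [Polynomial.eval_monomial] using (hX.pow n).const_mul a

end HasFiniteMoments

theorem hasFiniteMoments_eval_gaussianReal (f : Polynomial ℝ) :
    HasFiniteMoments (fun x ↦ f.eval x) (gaussianReal 0 1) :=
  HasFiniteMoments.eval (X := id) (fun p ↦ memLp_id_gaussianReal p) f

end Moments

section GaussianIntegrationByParts

open scoped NNReal

theorem integrable_eval_mul_gaussianPDFReal (f : Polynomial ℝ) :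
    Integrable fun x ↦ f.eval x * gaussianPDFReal 0 1 x := by
  have h := (hasFiniteMoments_eval_gaussianReal f).integrable
  rw [gaussianReal_of_var_ne_zero _ one_ne_zero,
    integrable_withDensity_iff (measurable_gaussianPDF 0 1) (by simp [gaussianPDF_lt_top])] at h
  simpa only [toReal_gaussianPDF] using h

theorem hasDerivAt_gaussianPDFReal (x : ℝ) :
    HasDerivAt (gaussianPDFReal 0 1) (-(x * gaussianPDFReal 0 1 x)) x := by
  rw [gaussianPDFReal_def]
  have hexponent : HasDerivAt (fun y : ℝ ↦ -(y - 0) ^ 2 / (2 * ((1 : ℝ≥0) : ℝ))) (-x) x := by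
    convert! (((hasDerivAt_id x).sub_const 0).pow 2).neg.div_const (2 * ((1 : ℝ≥0) : ℝ)) using 1
    simp
    ring
  convert! hexponent.exp.const_mul _ using 1
  ring

theorem integral_id_mul_eval_gaussianReal (f : Polynomial ℝ) :
    ∫ x, x * f.eval x ∂(gaussianReal 0 1) = ∫ x, f.derivative.eval x ∂(gaussianReal 0 1) := by
  simp only [integral_gaussianReal_eq_integral_smul one_ne_zero, smul_eq_mul]
  have hparts := integral_mul_deriv_eq_deriv_mul_of_integrable (A := ℝ)
    (u := fun x ↦ f.eval x) (v := gaussianPDFReal 0 1) (u' := fun x ↦ f.derivative.eval x)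
    (v' := fun x ↦ -(x * gaussianPDFReal 0 1 x)) (fun x _ ↦ f.hasDerivAt x)
    (fun x _ ↦ hasDerivAt_gaussianPDFReal x)
    ((integrable_eval_mul_gaussianPDFReal (-(Polynomial.X * f))).congr <| .of_forall fun x ↦ by
      simp only [Polynomial.eval_neg, Polynomial.eval_mul, Polynomial.eval_X, Pi.mul_apply]
      ring)
    (integrable_eval_mul_gaussianPDFReal _) (integrable_eval_mul_gaussianPDFReal _)
  calc ∫ x, gaussianPDFReal 0 1 x * (x * f.eval x)
      = -∫ x, f.eval x * -(x * gaussianPDFReal 0 1 x) := by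
        rw [← integral_neg]
        exact integral_congr_ae (.of_forall fun x ↦ by ring)
    _ = ∫ x, gaussianPDFReal 0 1 x * f.derivative.eval x := by
        rw [hparts, neg_neg]
        exact integral_congr_ae (.of_forall fun x ↦ mul_comm _ _)

theorem integral_prod_id_mul_eval_sub_gaussianReal {S : Type*} [MeasurableSpace S] {ν : Measure S}
    [SFinite ν] {q : S → Polynomial ℝ}
    (hq : Integrable (fun z : ℝ × S ↦ z.1 * (q z.2).eval z.1 - (q z.2).derivative.eval z.1)
      ((gaussianReal 0 1).prod ν)) :
    ∫ z : ℝ × S, z.1 * (q z.2).eval z.1 - (q z.2).derivative.eval z.1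
      ∂((gaussianReal 0 1).prod ν) = 0 := by
  rw [integral_prod_symm _ hq]
  refine integral_eq_zero_of_ae (.of_forall fun s ↦ ?_)
  have hid := (hasFiniteMoments_eval_gaussianReal (Polynomial.X * q s)).integrable
  simp only [Polynomial.eval_mul, Polynomial.eval_X] at hid
  simp only [Pi.zero_apply]
  rw [integral_sub hid (hasFiniteMoments_eval_gaussianReal _).integrable,
    integral_id_mul_eval_gaussianReal, sub_self]

end GaussianIntegrationByParts

section Mehler

variable {Ω : Type*} [MeasurableSpace Ω] {P : Measure Ω} {X Y : Ω → ℝ}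

theorem indepFun_sub_covariance_mul
    (hXY : HasGaussianLaw (fun ω ↦ (X ω, Y ω)) P) (hX1 : variance X P = 1) :
    IndepFun X (fun ω ↦ Y ω - covariance X Y P * X ω) P := by
  have := hXY.isProbabilityMeasure
  have hX : MemLp X 2 P := hXY.fst.memLp (by simp)
  have hY : MemLp Y 2 P := hXY.snd.memLp (by simp)
  have hlaw : HasGaussianLaw (fun ω ↦ (X ω, Y ω - covariance X Y P * X ω)) P :=
    hXY.map_fun ((ContinuousLinearMap.fst ℝ ℝ ℝ).prod
      (ContinuousLinearMap.snd ℝ ℝ ℝ - covariance X Y P • ContinuousLinearMap.fst ℝ ℝ ℝ))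
  refine hlaw.indepFun_of_covariance_eq_zero ?_
  rw [covariance_fun_sub_right hX hY (hX.const_mul _), covariance_const_mul_right,
    covariance_self hXY.fst.aemeasurable, hX1, mul_one, sub_self]

theorem map_prodMk_sub_covariance_mul (hXY : HasGaussianLaw (fun ω ↦ (X ω, Y ω)) P)
    (hX0 : ∫ ω, X ω ∂P = 0) (hX1 : variance X P = 1) :
    P.map (fun ω ↦ (X ω, Y ω - covariance X Y P * X ω))
      = (gaussianReal 0 1).prod (P.map fun ω ↦ Y ω - covariance X Y P * X ω) := by
  have := hXY.isProbabilityMeasure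
  refine ((indepFun_iff_map_prod_eq_prod_map_map hXY.fst.aemeasurable
    (hXY.snd.aemeasurable.sub (hXY.fst.aemeasurable.const_mul _))).1
    (indepFun_sub_covariance_mul hXY hX1)).trans ?_
  rw [hXY.fst.map_eq_gaussianReal, hX0, hX1, Real.toNNReal_one]
  rfl

theorem integral_mul_eval_sub_mul_eval (hXY : HasGaussianLaw (fun ω ↦ (X ω, Y ω)) P)
    (hX0 : ∫ ω, X ω ∂P = 0) (hX1 : variance X P = 1) (f g : Polynomial ℝ) :
    ∫ ω, (X ω * f.eval (X ω) - f.derivative.eval (X ω)) * g.eval (Y ω) ∂P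
      = covariance X Y P * ∫ ω, f.eval (X ω) * g.derivative.eval (Y ω) ∂P := by
  have := hXY.isProbabilityMeasure
  have hX : HasFiniteMoments X P := fun p ↦ hXY.fst.memLp (by simp)
  have hY : HasFiniteMoments Y P := fun p ↦ hXY.snd.memLp (by simp)
  have hlaw := map_prodMk_sub_covariance_mul hXY hX0 hX1
  set ρ := covariance X Y P
  set W : Ω → ℝ := fun ω ↦ Y ω - ρ * X ω
  have hXW : AEMeasurable (fun ω ↦ (X ω, W ω)) P :=
    hXY.fst.aemeasurable.prodMk (hXY.snd.aemeasurable.sub (hXY.fst.aemeasurable.const_mul ρ))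
  have : IsProbabilityMeasure (P.map W) := Measure.isProbabilityMeasure_map hXW.snd
  -- Conditionally on `W`, integrate by parts against the polynomial `x ↦ f x * g (ρ x + W)`.
  set q : ℝ → Polynomial ℝ := fun w ↦ f * g.comp (Polynomial.C ρ * Polynomial.X + Polynomial.C w)
  set F : ℝ × ℝ → ℝ := fun z ↦ z.1 * (q z.2).eval z.1 - (q z.2).derivative.eval z.1
  have hF (x y : ℝ) : F (x, y - ρ * x)
      = (x * f.eval x - f.derivative.eval x) * g.eval y - ρ * (f.eval x * g.derivative.eval y) := by
    simp [F, q, Polynomial.derivative_comp]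
    ring
  have hFc : Continuous F := by
    simp only [F, q, Polynomial.derivative_mul, Polynomial.derivative_comp, Polynomial.eval_mul,
      Polynomial.eval_add, Polynomial.eval_comp, Polynomial.eval_C, Polynomial.eval_X,
      Polynomial.derivative_add, Polynomial.derivative_C, Polynomial.derivative_X,
      Polynomial.eval_zero, Polynomial.eval_one]
    fun_prop
  have hleft := ((hX.eval (Polynomial.X * f - f.derivative)).mul (hY.eval g)).integrable
  simp only [Polynomial.eval_sub, Polynomial.eval_mul, Polynomial.eval_X] at hleft
  have hright := (((hX.eval f).mul (hY.eval g.derivative)).const_mul ρ).integrable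
  have hFint : Integrable F ((gaussianReal 0 1).prod (P.map W)) := by
    rw [← hlaw, integrable_map_measure hFc.aestronglyMeasurable hXW]
    exact (hleft.sub hright).congr (.of_forall fun ω ↦ (hF _ _).symm)
  rw [← integral_const_mul, ← sub_eq_zero, ← integral_sub hleft hright,
    ← integral_prod_id_mul_eval_sub_gaussianReal hFint, ← hlaw,
    integral_map hXW hFc.aestronglyMeasurable]
  exact integral_congr_ae (.of_forall fun ω ↦ (hF _ _).symm)

theorem derivative_hermite_succ (n : ℕ) :
    (Polynomial.hermite (n + 1)).derivative = (n + 1) * Polynomial.hermite n := by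
  induction n with
  | zero => simp
  | succ n ih =>
    rw [Polynomial.hermite_succ (n + 1), Polynomial.derivative_sub, Polynomial.derivative_mul, ih,
      Polynomial.derivative_X, Polynomial.derivative_mul,
      show Polynomial.derivative ((n : Polynomial ℤ) + 1) = 0 by simp]
    push_cast
    linear_combination (-(n : Polynomial ℤ) - 1) * Polynomial.hermite_succ n

/-- The probabilists' Hermite polynomial `H_k` with real coefficients. -/
noncomputable def hermiteReal (k : ℕ) : Polynomial ℝ :=
  (Polynomial.hermite k).map (Int.castRingHom ℝ)

theorem aeval_hermite (k : ℕ) (x : ℝ) :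
    Polynomial.aeval x (Polynomial.hermite k) = (hermiteReal k).eval x := by
  rw [hermiteReal, Polynomial.eval_map]
  rfl

theorem hermiteReal_zero : hermiteReal 0 = 1 := by simp [hermiteReal]

theorem hermiteReal_succ (k : ℕ) :
    hermiteReal (k + 1) = Polynomial.X * hermiteReal k - (hermiteReal k).derivative := by
  simp [hermiteReal, Polynomial.hermite_succ, Polynomial.derivative_map]

theorem derivative_hermiteReal_succ (k : ℕ) :
    (hermiteReal (k + 1)).derivative = Polynomial.C ((k : ℝ) + 1) * hermiteReal k := by
  rw [hermiteReal, Polynomial.derivative_map, derivative_hermite_succ]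
  simp [hermiteReal]

theorem integral_hermiteReal_succ_mul (hXY : HasGaussianLaw (fun ω ↦ (X ω, Y ω)) P)
    (hX0 : ∫ ω, X ω ∂P = 0) (hX1 : variance X P = 1) (k : ℕ) (g : Polynomial ℝ) :
    ∫ ω, (hermiteReal (k + 1)).eval (X ω) * g.eval (Y ω) ∂P
      = covariance X Y P * ∫ ω, (hermiteReal k).eval (X ω) * g.derivative.eval (Y ω) ∂P := by
  rw [← integral_mul_eval_sub_mul_eval hXY hX0 hX1]
  simp [hermiteReal_succ]

theorem integral_hermiteReal_mul_hermiteReal (hXY : HasGaussianLaw (fun ω ↦ (X ω, Y ω)) P)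
    (hX0 : ∫ ω, X ω ∂P = 0) (hX1 : variance X P = 1) (hY0 : ∫ ω, Y ω ∂P = 0)
    (hY1 : variance Y P = 1) (k l : ℕ) :
    ∫ ω, (hermiteReal k).eval (X ω) * (hermiteReal l).eval (Y ω) ∂P
      = if k = l then (k.factorial : ℝ) * covariance X Y P ^ k else 0 := by
  have := hXY.isProbabilityMeasure
  induction k generalizing l with
  | zero =>
    cases l with
    | zero => simp [hermiteReal_zero]
    | succ l =>
      have hYX : HasGaussianLaw (fun ω ↦ (Y ω, X ω)) P := by
        simpa using
          hXY.map_fun ((ContinuousLinearMap.snd ℝ ℝ ℝ).prod (ContinuousLinearMap.fst ℝ ℝ ℝ))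
      simpa [hermiteReal_zero] using integral_hermiteReal_succ_mul hYX hY0 hY1 l 1
  | succ k ih =>
    rw [integral_hermiteReal_succ_mul hXY hX0 hX1]
    cases l with
    | zero => simp [hermiteReal_zero]
    | succ l =>
      simp only [derivative_hermiteReal_succ, Polynomial.eval_mul, Polynomial.eval_C,
        mul_left_comm _ ((l : ℝ) + 1), integral_const_mul, ih l, add_left_inj]
      split_ifs with hkl
      · subst hkl
        rw [Nat.factorial_succ]
        push_cast
        ring
      · simp

end Mehler

section FourierUniqueness

variable {E : Type*} [NormedAddCommGroup E] [NormedSpace ℝ E] [CompleteSpace E] [MeasurableSpace E]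
  [BorelSpace E] [SecondCountableTopology E] {μ : Measure E} [SigmaFinite μ]

theorem ae_eq_zero_of_forall_integral_mul_cexp_dual_eq_zero {f : E → ℝ} (hf : Integrable f μ)
    (h : ∀ ℓ : StrongDual ℝ E, ∫ x, (f x : ℂ) * Complex.exp (ℓ x * Complex.I) ∂μ = 0) :
    f =ᵐ[μ] 0 := by
  have hpos : AEMeasurable (fun x ↦ ENNReal.ofReal (f x)) μ := hf.aemeasurable.ennreal_ofReal
  have hneg : AEMeasurable (fun x ↦ ENNReal.ofReal (-f x)) μ := hf.aemeasurable.neg.ennreal_ofReal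
  have : IsFiniteMeasure (μ.withDensity fun x ↦ ENNReal.ofReal (f x)) :=
    isFiniteMeasure_withDensity_ofReal hf.2
  have : IsFiniteMeasure (μ.withDensity fun x ↦ ENNReal.ofReal (-f x)) :=
    isFiniteMeasure_withDensity_ofReal hf.neg.2
  -- The positive and the negative part of `f` are densities of measures with the same
  -- characteristic function.
  have heq : μ.withDensity (fun x ↦ ENNReal.ofReal (f x))
      = μ.withDensity fun x ↦ ENNReal.ofReal (-f x) := by
    refine Measure.ext_of_charFunDual (funext fun ℓ ↦ ?_)
    have hint {g : E → ℝ} (hg : Integrable g μ) :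
        Integrable (fun x ↦ max (g x) 0 • Complex.exp (ℓ x * Complex.I)) μ :=
      hg.pos_part.smul_bdd 1 (by fun_prop)
        (.of_forall fun x ↦ (Complex.norm_exp_ofReal_mul_I _).le)
    simp only [charFunDual_apply]
    rw [integral_withDensity_eq_integral_toReal_smul₀ hpos (by simp),
      integral_withDensity_eq_integral_toReal_smul₀ hneg (by simp), ← sub_eq_zero]
    simp only [ENNReal.toReal_ofReal']
    rw [← integral_sub (hint hf) (hint hf.fun_neg), ← h ℓ]
    refine integral_congr_ae (.of_forall fun x ↦ ?_)
    simp only [Complex.real_smul, ← sub_mul, ← Complex.ofReal_sub,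
      max_zero_sub_max_neg_zero_eq_self]
  filter_upwards [(withDensity_eq_iff_of_sigmaFinite hpos hneg).1 heq] with x hx
  rcases le_total 0 (f x) with hfx | hfx
  · rw [ENNReal.ofReal_of_nonpos (neg_nonpos.2 hfx), ENNReal.ofReal_eq_zero] at hx
    exact le_antisymm hx hfx
  · rw [ENNReal.ofReal_of_nonpos hfx, eq_comm, ENNReal.ofReal_eq_zero] at hx
    exact le_antisymm hfx (neg_nonpos.1 hx)

end FourierUniqueness

theorem integral_mul_cexp_eq_zero_of_forall_integral_mul_pow_eq_zero {S : Type*}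
    [MeasurableSpace S] {μ : Measure S} {f X : S → ℝ} (hf : MemLp f 2 μ) (hX : AEMeasurable X μ)
    (hexp : MemLp (fun s ↦ Real.exp |X s|) 2 μ) (h : ∀ n : ℕ, ∫ s, f s * X s ^ n ∂μ = 0) :
    ∫ s, (f s : ℂ) * Complex.exp (X s * Complex.I) ∂μ = 0 := by
  have hbound (s : S) : HasSum (fun n : ℕ ↦ |f s| * (|X s| ^ n / n.factorial))
      (|f s| * Real.exp |X s|) := by
    rw [Real.exp_eq_exp_ℝ]
    exact (NormedSpace.expSeries_div_hasSum_exp |X s|).mul_left _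
  have hseries (s : S) : HasSum (fun n : ℕ ↦ (f s : ℂ) * ((X s * Complex.I) ^ n / n.factorial))
      (f s * Complex.exp (X s * Complex.I)) := by
    rw [Complex.exp_eq_exp_ℂ]
    exact (NormedSpace.expSeries_div_hasSum_exp (X s * Complex.I)).mul_left _
  have hfm : AEMeasurable (fun s ↦ (f s : ℂ)) μ :=
    Complex.measurable_ofReal.comp_aemeasurable hf.aestronglyMeasurable.aemeasurable
  have hXm : AEMeasurable (fun s ↦ (X s : ℂ)) μ := Complex.measurable_ofReal.comp_aemeasurable hX
  have hsum := hasSum_integral_of_dominated_convergence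
    (F := fun (n : ℕ) s ↦ (f s : ℂ) * ((X s * Complex.I) ^ n / n.factorial))
    (fun (n : ℕ) s ↦ |f s| * (|X s| ^ n / n.factorial))
    (fun n ↦ (hfm.mul (((hXm.mul_const _).pow_const n).div_const _)).aestronglyMeasurable)
    (fun n ↦ .of_forall fun s ↦ by simp)
    (.of_forall fun s ↦ (hbound s).summable)
    ((hf.abs.integrable_mul hexp).congr (.of_forall fun s ↦ (hbound s).tsum_eq.symm))
    (.of_forall hseries)
  have hterm (n : ℕ) : ∫ s, (f s : ℂ) * ((X s * Complex.I) ^ n / n.factorial) ∂μ = 0 := by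
    have hcast (s : S) : (f s : ℂ) * ((X s * Complex.I) ^ n / n.factorial)
        = Complex.I ^ n / n.factorial * ((f s * X s ^ n : ℝ) : ℂ) := by
      push_cast
      ring
    simp only [hcast]
    rw [integral_const_mul, integral_complex_ofReal, h n, Complex.ofReal_zero, mul_zero]
  simpa only [hterm] using hsum.unique (by simpa only [hterm] using hasSum_zero)

section HermiteBasis

open scoped NNReal

variable {ι : Type*} [Fintype ι] {f : (ι → ℝ) → ℝ}

instance : IsProbabilityMeasure (stdGaussianMeasure ι) := by
  unfold stdGaussianMeasure
  infer_instance

theorem hermiteProd_eq_prod_eval (v : ι → ℕ) (w : ι → ℝ) :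
    hermiteProd v w = ∏ j, (hermiteReal (v j)).eval (w j) := by
  simp [hermiteProd, aeval_hermite]

theorem hermiteProd_zero : hermiteProd (0 : ι → ℕ) = 1 := by
  ext w
  simp [hermiteProd]

theorem hasFiniteMoments_apply_stdGaussianMeasure (j : ι) :
    HasFiniteMoments (fun w : ι → ℝ ↦ w j) (stdGaussianMeasure ι) := fun p ↦
  (memLp_id_gaussianReal (μ := 0) (v := 1) p).comp_measurePreserving
    (measurePreserving_eval (fun _ : ι ↦ gaussianReal 0 1) j)

theorem memLp_hermiteProd (v : ι → ℕ) : MemLp (hermiteProd v) 2 (stdGaussianMeasure ι) := by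
  simp only [funext (hermiteProd_eq_prod_eval v)]
  exact (HasFiniteMoments.prod Finset.univ fun j _ ↦
    (hasFiniteMoments_apply_stdGaussianMeasure j).eval _).memLp_two

theorem integrable_mul_hermiteProd (hf : MemLp f 2 (stdGaussianMeasure ι)) (v : ι → ℕ) :
    Integrable (fun w ↦ f w * hermiteProd v w) (stdGaussianMeasure ι) :=
  hf.integrable_mul (memLp_hermiteProd v)

/-- The Hermite polynomials as a polynomial sequence, which gives access to their being a basis. -/
noncomputable def hermiteSequence : Polynomial.Sequence ℝ where
  elems' := hermiteReal
  degree_eq' i := by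
    rw [hermiteReal, Polynomial.degree_map_eq_of_injective Int.cast_injective,
      Polynomial.degree_hermite]

theorem exists_eval_eq_sum_hermiteReal (p : Polynomial ℝ) :
    ∃ c : ℕ →₀ ℝ, ∀ x, p.eval x = ∑ k ∈ c.support, c k * (hermiteReal k).eval x := by
  have hspan : Submodule.span ℝ (Set.range hermiteReal) = ⊤ := hermiteSequence.span fun i ↦ by
    change IsUnit (hermiteReal i).leadingCoeff
    rw [hermiteReal, ((Polynomial.hermite_monic i).map _).leadingCoeff]
    exact isUnit_one
  obtain ⟨c, rfl⟩ :=
    Finsupp.mem_span_range_iff_exists_finsupp.1 (hspan ▸ Submodule.mem_top (x := p))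
  refine ⟨c, fun x ↦ ?_⟩
  rw [Finsupp.sum, Polynomial.eval_finsetSum]
  simp

theorem integral_mul_prod_pow_eq_zero (hf : MemLp f 2 (stdGaussianMeasure ι))
    (h0 : ∀ v, hermiteCoeff f v = 0) (k : ι → ℕ) :
    ∫ w, f w * ∏ j, w j ^ k j ∂(stdGaussianMeasure ι) = 0 := by
  classical
  choose c hc using fun j ↦ exists_eval_eq_sum_hermiteReal (Polynomial.X ^ k j)
  simp only [Polynomial.eval_pow, Polynomial.eval_X] at hc
  have hexpand (w : ι → ℝ) : f w * ∏ j, w j ^ k j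
      = ∑ v ∈ Fintype.piFinset fun j ↦ (c j).support,
          (∏ j, c j (v j)) * (f w * hermiteProd v w) := by
    simp only [hc, Finset.prod_univ_sum, Finset.mul_sum, Finset.prod_mul_distrib,
      hermiteProd_eq_prod_eval]
    exact Finset.sum_congr rfl fun v _ ↦ by ring
  simp only [hexpand]
  rw [integral_finsetSum _ fun v _ ↦ (integrable_mul_hermiteProd hf v).const_mul _]
  refine Finset.sum_eq_zero fun v _ ↦ ?_
  rw [integral_const_mul, ← hermiteCoeff, h0, mul_zero]

theorem integral_mul_mvPolynomial_eval_eq_zero (hf : MemLp f 2 (stdGaussianMeasure ι))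
    (h0 : ∀ v, hermiteCoeff f v = 0) (p : MvPolynomial ι ℝ) :
    ∫ w, f w * MvPolynomial.eval w p ∂(stdGaussianMeasure ι) = 0 := by
  simp only [MvPolynomial.eval_eq', Finset.mul_sum, mul_left_comm (f _)]
  have hint (k : ι →₀ ℕ) : Integrable (fun w ↦ f w * ∏ j, w j ^ k j) (stdGaussianMeasure ι) :=
    hf.integrable_mul (HasFiniteMoments.prod Finset.univ fun j _ ↦
      (hasFiniteMoments_apply_stdGaussianMeasure j).pow (k j)).memLp_two
  rw [integral_finsetSum _ fun k _ ↦ (hint k).const_mul _]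
  refine Finset.sum_eq_zero fun k _ ↦ ?_
  rw [integral_const_mul, integral_mul_prod_pow_eq_zero hf h0, mul_zero]

theorem dual_apply_eq_sum (ℓ : StrongDual ℝ (ι → ℝ)) :
    ∃ a : ι → ℝ, ∀ w, ℓ w = ∑ j, a j * w j := by
  classical
  refine ⟨fun j ↦ ℓ fun i ↦ if j = i then 1 else 0, fun w ↦ ?_⟩
  simp only [mul_comm (ℓ _)]
  exact (ℓ : (ι → ℝ) →ₗ[ℝ] ℝ).pi_apply_eq_sum_univ w

theorem integrable_exp_dual (ℓ : StrongDual ℝ (ι → ℝ)) :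
    Integrable (fun w ↦ Real.exp (ℓ w)) (stdGaussianMeasure ι) := by
  obtain ⟨a, ha⟩ := dual_apply_eq_sum ℓ
  simp only [ha, Real.exp_sum]
  exact Integrable.fintype_prod (f := fun j x ↦ Real.exp (a j * x)) fun j ↦
    integrable_exp_mul_gaussianReal _

theorem memLp_exp_abs_dual (ℓ : StrongDual ℝ (ι → ℝ)) :
    MemLp (fun w ↦ Real.exp |ℓ w|) 2 (stdGaussianMeasure ι) := by
  have hcont : Continuous fun w ↦ Real.exp |ℓ w| := by fun_prop
  refine (memLp_two_iff_integrable_sq hcont.aestronglyMeasurable).2 ?_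
  have h := integrable_exp_mul_abs (X := ℓ) (t := 2) (μ := stdGaussianMeasure ι)
    (by simpa using integrable_exp_dual ((2 : ℝ) • ℓ))
    (by simpa using integrable_exp_dual ((-2 : ℝ) • ℓ))
  exact h.congr (.of_forall fun w ↦ by simp [← Real.exp_nat_mul])

theorem ae_eq_zero_of_forall_hermiteCoeff_eq_zero (hf : MemLp f 2 (stdGaussianMeasure ι))
    (h0 : ∀ v, hermiteCoeff f v = 0) : f =ᵐ[stdGaussianMeasure ι] 0 := by
  refine ae_eq_zero_of_forall_integral_mul_cexp_dual_eq_zero (hf.integrable one_le_two) fun ℓ ↦ ?_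
  refine integral_mul_cexp_eq_zero_of_forall_integral_mul_pow_eq_zero hf
    ℓ.continuous.measurable.aemeasurable (memLp_exp_abs_dual ℓ) fun n ↦ ?_
  obtain ⟨a, ha⟩ := dual_apply_eq_sum ℓ
  have hp (w : ι → ℝ) :
      MvPolynomial.eval w ((∑ j, a j • MvPolynomial.X j) ^ n) = (∑ j, a j * w j) ^ n := by
    simp only [map_pow, map_sum, MvPolynomial.smul_eval, MvPolynomial.eval_X]
  simpa only [ha, hp] using
    integral_mul_mvPolynomial_eval_eq_zero hf h0 ((∑ j, a j • MvPolynomial.X j) ^ n)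

/-- The multi-index factorial `v! = ∏ (v_j)!`, the squared norm of `e_v` in `L²`. -/
def factorialProd (v : ι → ℕ) : ℝ := ∏ j, ((v j).factorial : ℝ)

theorem factorialProd_pos (v : ι → ℕ) : 0 < factorialProd v :=
  Finset.prod_pos fun j _ ↦ by positivity

theorem integral_hermiteReal_mul_hermiteReal_gaussianReal (k l : ℕ) :
    ∫ x, (hermiteReal k).eval x * (hermiteReal l).eval x ∂(gaussianReal 0 1)
      = if k = l then (k.factorial : ℝ) else 0 := by
  have hlaw : HasGaussianLaw (fun x : ℝ ↦ (x, x)) (gaussianReal 0 1) :=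
    (IsGaussian.hasGaussianLaw_id (μ := gaussianReal 0 1)).map_fun
      ((ContinuousLinearMap.id ℝ ℝ).prod (ContinuousLinearMap.id ℝ ℝ))
  have hvar : variance (fun x : ℝ ↦ x) (gaussianReal 0 1) = 1 := by simp
  simpa only [covariance_self aemeasurable_id', hvar, one_pow, mul_one] using
    integral_hermiteReal_mul_hermiteReal hlaw (by simp) hvar (by simp) hvar k l

open Classical in
theorem hermiteCoeff_hermiteProd (u v : ι → ℕ) :
    hermiteCoeff (hermiteProd u) v = if u = v then factorialProd u else 0 := by
  simp only [hermiteCoeff, hermiteProd_eq_prod_eval, ← Finset.prod_mul_distrib, stdGaussianMeasure]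
  rw [integral_fintype_prod_eq_prod (𝕜 := ℝ)
    (fun j x ↦ (hermiteReal (u j)).eval x * (hermiteReal (v j)).eval x)]
  simp only [integral_hermiteReal_mul_hermiteReal_gaussianReal]
  split_ifs with huv
  · simp [huv, factorialProd]
  · obtain ⟨j, hj⟩ := Function.ne_iff.1 huv
    exact Finset.prod_eq_zero (Finset.mem_univ j) (if_neg hj)

theorem hermiteCoeff_congr {g : (ι → ℝ) → ℝ} (h : f =ᵐ[stdGaussianMeasure ι] g) (v : ι → ℕ) :
    hermiteCoeff f v = hermiteCoeff g v :=
  integral_congr_ae (h.mul (ae_eq_refl _))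

/-- The Hermite polynomial `e_v / √v!` of norm one, as an element of `L²`. -/
noncomputable def hermiteLp (v : ι → ℕ) : Lp ℝ 2 (stdGaussianMeasure ι) :=
  (√(factorialProd v))⁻¹ • (memLp_hermiteProd v).toLp (hermiteProd v)

theorem inner_hermiteLp (v : ι → ℕ) (g : Lp ℝ 2 (stdGaussianMeasure ι)) :
    inner ℝ (hermiteLp v) g = (√(factorialProd v))⁻¹ * hermiteCoeff g v := by
  rw [hermiteLp, real_inner_smul_left, L2.inner_def, hermiteCoeff]
  congr 1
  refine integral_congr_ae ?_
  filter_upwards [(memLp_hermiteProd v).coeFn_toLp] with w hw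
  rw [hw]
  simp

theorem orthonormal_hermiteLp : Orthonormal ℝ (hermiteLp (ι := ι)) := by
  classical
  rw [orthonormal_iff_ite]
  intro u v
  rw [hermiteLp.eq_def v, real_inner_smul_right, inner_hermiteLp,
    hermiteCoeff_congr (memLp_hermiteProd v).coeFn_toLp, hermiteCoeff_hermiteProd]
  rcases eq_or_ne u v with rfl | huv
  · rw [if_pos rfl, if_pos rfl, ← mul_assoc, ← mul_inv, Real.mul_self_sqrt (factorialProd_pos u).le,
      inv_mul_cancel₀ (factorialProd_pos u).ne']
  · simp [huv, huv.symm]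

theorem orthogonal_span_hermiteLp :
    (Submodule.span ℝ (Set.range (hermiteLp (ι := ι))))ᗮ = ⊥ := by
  refine (Submodule.eq_bot_iff _).2 fun g hg ↦ Lp.eq_zero_iff_ae_eq_zero.2 <|
    ae_eq_zero_of_forall_hermiteCoeff_eq_zero (Lp.memLp g) fun v ↦ ?_
  have hinner := (Submodule.mem_orthogonal _ _).1 hg _ (Submodule.subset_span ⟨v, rfl⟩)
  rw [inner_hermiteLp] at hinner
  exact (mul_eq_zero.1 hinner).resolve_left
    (inv_pos.2 (Real.sqrt_pos.2 (factorialProd_pos v))).ne'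

theorem hasSum_hermiteCoeff_sq_div (hf : MemLp f 2 (stdGaussianMeasure ι)) :
    HasSum (fun v ↦ hermiteCoeff f v ^ 2 / factorialProd v)
      (∫ w, f w ^ 2 ∂(stdGaussianMeasure ι)) := by
  have h := (HilbertBasis.mkOfOrthogonalEqBot orthonormal_hermiteLp
    orthogonal_span_hermiteLp).hasSum_inner_mul_inner (hf.toLp f) (hf.toLp f)
  have hnorm : inner ℝ (hf.toLp f) (hf.toLp f) = ∫ w, f w ^ 2 ∂(stdGaussianMeasure ι) := by
    rw [L2.inner_def]
    refine integral_congr_ae ?_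
    filter_upwards [hf.coeFn_toLp] with w hw
    simp [hw, sq]
  convert! h using 2 with v
  · rw [HilbertBasis.coe_mkOfOrthogonalEqBot, real_inner_comm, inner_hermiteLp,
      hermiteCoeff_congr hf.coeFn_toLp, ← sq, mul_pow, inv_pow,
      Real.sq_sqrt (factorialProd_pos v).le, inv_mul_eq_div]
  · exact hnorm.symm

/-- The partial sum `∑_{v ∈ s} (C_v / v!) e_v` of the Hermite expansion of `f`. -/
noncomputable def hermitePartialSum (f : (ι → ℝ) → ℝ) (s : Finset (ι → ℕ)) (w : ι → ℝ) : ℝ :=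
  ∑ v ∈ s, hermiteCoeff f v / factorialProd v * hermiteProd v w

theorem memLp_hermitePartialSum (s : Finset (ι → ℕ)) :
    MemLp (hermitePartialSum f s) 2 (stdGaussianMeasure ι) :=
  memLp_finsetSum s fun v _ ↦ (memLp_hermiteProd v).const_mul _

theorem integral_mul_hermitePartialSum {g : (ι → ℝ) → ℝ} (hg : MemLp g 2 (stdGaussianMeasure ι))
    (s : Finset (ι → ℕ)) :
    ∫ w, g w * hermitePartialSum f s w ∂(stdGaussianMeasure ι)
      = ∑ v ∈ s, hermiteCoeff f v * hermiteCoeff g v / factorialProd v := by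
  simp only [hermitePartialSum, Finset.mul_sum, mul_left_comm (g _)]
  rw [integral_finsetSum _ fun v _ ↦ (integrable_mul_hermiteProd hg v).const_mul _]
  refine Finset.sum_congr rfl fun v _ ↦ ?_
  rw [integral_const_mul, ← hermiteCoeff, div_mul_eq_mul_div]

open Classical in
theorem hermiteCoeff_hermitePartialSum (s : Finset (ι → ℕ)) (v : ι → ℕ) :
    hermiteCoeff (hermitePartialSum f s) v = if v ∈ s then hermiteCoeff f v else 0 := by
  have h := integral_mul_hermitePartialSum (f := f) (memLp_hermiteProd v) s
  simp only [mul_comm (hermiteProd v _), hermiteCoeff_hermiteProd] at h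
  rw [hermiteCoeff, h]
  have hterm (u : ι → ℕ) :
      hermiteCoeff f u * (if v = u then factorialProd v else 0) / factorialProd u
        = if v = u then hermiteCoeff f v else 0 := by
    split_ifs with huv
    · rw [huv, mul_div_cancel_right₀ _ (factorialProd_pos u).ne']
    · simp
  simp only [hterm, Finset.sum_ite_eq]

open Classical in
theorem hermiteCoeff_sub_hermitePartialSum (hf : MemLp f 2 (stdGaussianMeasure ι))
    (s : Finset (ι → ℕ)) (v : ι → ℕ) :
    hermiteCoeff (fun w ↦ f w - hermitePartialSum f s w) v
      = if v ∈ s then 0 else hermiteCoeff f v := by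
  simp only [hermiteCoeff, sub_mul]
  rw [integral_sub (integrable_mul_hermiteProd hf v)
    (integrable_mul_hermiteProd (memLp_hermitePartialSum s) v), ← hermiteCoeff, ← hermiteCoeff,
    hermiteCoeff_hermitePartialSum]
  split_ifs <;> simp

theorem integral_sub_hermitePartialSum_sq (hf : MemLp f 2 (stdGaussianMeasure ι))
    (s : Finset (ι → ℕ)) :
    ∫ w, (f w - hermitePartialSum f s w) ^ 2 ∂(stdGaussianMeasure ι)
      = ∫ w, f w ^ 2 ∂(stdGaussianMeasure ι) - ∑ v ∈ s, hermiteCoeff f v ^ 2 / factorialProd v := by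
  have hQ := memLp_hermitePartialSum (f := f) s
  have hfQ : Integrable (fun w ↦ 2 * (f w * hermitePartialSum f s w)) (stdGaussianMeasure ι) :=
    (hf.integrable_mul hQ).const_mul 2
  have hsq (w : ι → ℝ) : (f w - hermitePartialSum f s w) ^ 2
      = f w ^ 2 - 2 * (f w * hermitePartialSum f s w) + hermitePartialSum f s w ^ 2 := by
    ring
  have hnorm : ∫ w, hermitePartialSum f s w ^ 2 ∂(stdGaussianMeasure ι)
      = ∑ v ∈ s, hermiteCoeff f v ^ 2 / factorialProd v := by
    classical
    simp only [sq (hermitePartialSum f s _)]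
    rw [integral_mul_hermitePartialSum hQ]
    refine Finset.sum_congr rfl fun v hv ↦ ?_
    rw [hermiteCoeff_hermitePartialSum, if_pos hv, sq]
  have hsub : Integrable (fun w ↦ f w ^ 2 - 2 * (f w * hermitePartialSum f s w))
      (stdGaussianMeasure ι) := hf.integrable_sq.sub hfQ
  simp only [hsq]
  rw [integral_add hsub hQ.integrable_sq, integral_sub hf.integrable_sq hfQ, integral_const_mul,
    integral_mul_hermitePartialSum hf, hnorm]
  simp only [← sq]
  ring

theorem tendsto_integral_sub_hermitePartialSum_sq (hf : MemLp f 2 (stdGaussianMeasure ι)) :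
    Tendsto (fun s ↦ ∫ w, (f w - hermitePartialSum f s w) ^ 2 ∂(stdGaussianMeasure ι)) atTop
      (𝓝 0) := by
  simp only [integral_sub_hermitePartialSum_sq hf]
  rw [← sub_self (∫ w, f w ^ 2 ∂(stdGaussianMeasure ι))]
  exact Tendsto.const_sub _ (hasSum_hermiteCoeff_sq_div hf)

end HermiteBasis

section Marginal

variable {S Ω E : Type*} [MeasurableSpace S] [MeasurableSpace Ω] [MeasurableSpace E]
  {X : S → Ω → E} {P : Measure Ω} {ν : Measure E}

/-- A measurable random field all of whose one-point laws are equal to `ν`. -/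
structure HasMarginal (X : S → Ω → E) (P : Measure Ω) (ν : Measure E) : Prop where
  measurable_uncurry : Measurable (Function.uncurry X)
  map_eq : ∀ s, P.map (X s) = ν

namespace HasMarginal

theorem measurable (hX : HasMarginal X P ν) (s : S) : Measurable (X s) :=
  hX.measurable_uncurry.comp measurable_prodMk_left

theorem comp (hX : HasMarginal X P ν) {T : Type*} [MeasurableSpace T] {a : T → S}
    (ha : Measurable a) : HasMarginal (fun t ↦ X (a t)) P ν where
  measurable_uncurry :=
    hX.measurable_uncurry.comp ((ha.comp measurable_fst).prodMk measurable_snd)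
  map_eq t := hX.map_eq (a t)

theorem memLp_comp (hX : HasMarginal X P ν) {F : E → ℝ} (hF : MemLp F 2 ν) (s : S) :
    MemLp (fun ω ↦ F (X s ω)) 2 P :=
  MemLp.comp_of_map (f := X s) (by rwa [hX.map_eq s]) (hX.measurable s).aemeasurable

theorem integral_comp (hX : HasMarginal X P ν) {F : E → ℝ} (hF : AEStronglyMeasurable F ν)
    (s : S) : ∫ ω, F (X s ω) ∂P = ∫ w, F w ∂ν := by
  rw [← hX.map_eq s] at hF ⊢
  rw [integral_map (hX.measurable s).aemeasurable hF]

theorem map_uncurry (hX : HasMarginal X P ν) [SFinite P] (m : Measure S) :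
    (m.prod P).map (Function.uncurry X) = m Set.univ • ν := by
  ext A hA
  have hslice (s : S) : P (Prod.mk s ⁻¹' (Function.uncurry X ⁻¹' A)) = ν A := by
    rw [← hX.map_eq s, Measure.map_apply (hX.measurable s) hA]
    rfl
  rw [Measure.map_apply hX.measurable_uncurry hA, Measure.prod_apply (hX.measurable_uncurry hA)]
  simp [hslice, mul_comm]

variable {F : E → ℝ} (hX : HasMarginal X P ν) (hF : MemLp F 2 ν)
include hX hF

theorem integral_mul_comp_le (s t : S) :
    ∫ ω, F (X s ω) * F (X t ω) ∂P ≤ ∫ w, F w ^ 2 ∂ν := by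
  have hsq (u : S) : ∫ ω, F (X u ω) ^ 2 ∂P = ∫ w, F w ^ 2 ∂ν :=
    hX.integral_comp (F := fun w ↦ F w ^ 2) (hF.aestronglyMeasurable.pow 2) u
  have hi (u : S) : Integrable (fun ω ↦ F (X u ω) ^ 2) P := (hX.memLp_comp hF u).integrable_sq
  calc ∫ ω, F (X s ω) * F (X t ω) ∂P
      ≤ ∫ ω, (F (X s ω) ^ 2 + F (X t ω) ^ 2) / 2 ∂P :=
        integral_mono ((hX.memLp_comp hF s).integrable_mul (hX.memLp_comp hF t))
          (((hi s).add (hi t)).div_const 2)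
          fun ω ↦ by linarith [two_mul_le_add_sq (F (X s ω)) (F (X t ω))]
    _ = ∫ w, F w ^ 2 ∂ν := by
        rw [integral_div, integral_add (hi s) (hi t), hsq, hsq, add_self_div_two]

theorem memLp_comp_uncurry [SFinite P] (m : Measure S) [IsFiniteMeasure m] :
    MemLp (fun z : S × Ω ↦ F (X z.1 z.2)) 2 (m.prod P) :=
  MemLp.comp_of_map (f := Function.uncurry X)
    (by rw [hX.map_uncurry m]; exact hF.smul_measure (measure_ne_top m _))
    hX.measurable_uncurry.aemeasurable

variable [IsFiniteMeasure P] (m : Measure S) [IsFiniteMeasure m]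

theorem integrable_comp_uncurry :
    Integrable (fun z : S × Ω ↦ F (X z.1 z.2)) (m.prod P) :=
  (hX.memLp_comp_uncurry hF m).integrable one_le_two

theorem integrable_mul_comp_uncurry :
    Integrable (fun z : (S × S) × Ω ↦ F (X z.1.1 z.2) * F (X z.1.2 z.2)) ((m.prod m).prod P) :=
  ((hX.comp measurable_fst).memLp_comp_uncurry hF (m.prod m)).integrable_mul
    ((hX.comp measurable_snd).memLp_comp_uncurry hF (m.prod m))

theorem ae_integrable_comp : ∀ᵐ ω ∂P, Integrable (fun s ↦ F (X s ω)) m :=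
  (hX.integrable_comp_uncurry hF m).prod_left_ae

theorem integral_integral_comp :
    ∫ ω, ∫ s, F (X s ω) ∂m ∂P = m.real Set.univ * ∫ w, F w ∂ν := by
  rw [integral_integral_swap (f := fun ω s ↦ F (X s ω)) (hX.integrable_comp_uncurry hF m).swap]
  simp [hX.integral_comp hF.aestronglyMeasurable]

theorem memLp_integral_comp : MemLp (fun ω ↦ ∫ s, F (X s ω) ∂m) 2 P := by
  refine (memLp_two_iff_integrable_sq
    (hX.integrable_comp_uncurry hF m).swap.aestronglyMeasurable.integral_prod_right').2 ?_
  refine (hX.integrable_mul_comp_uncurry hF m).integral_prod_right.congr (.of_forall fun ω ↦ ?_)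
  exact (integral_prod_mul (fun s ↦ F (X s ω)) fun s ↦ F (X s ω)).trans (sq _).symm

theorem integral_sub_comp_ae_eq {G : E → ℝ} (hG : MemLp G 2 ν) :
    (fun ω ↦ ∫ s, F (X s ω) - G (X s ω) ∂m)
      =ᵐ[P] fun ω ↦ ∫ s, F (X s ω) ∂m - ∫ s, G (X s ω) ∂m := by
  filter_upwards [hX.ae_integrable_comp hF m, hX.ae_integrable_comp hG m] with ω hω hωG
  rw [integral_sub hω hωG]

theorem integral_sq_integral_comp_le_sub_add {G : E → ℝ} (hG : MemLp G 2 ν) :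
    ∫ ω, (∫ s, F (X s ω) ∂m) ^ 2 ∂P
      ≤ 2 * (∫ ω, (∫ s, F (X s ω) - G (X s ω) ∂m) ^ 2 ∂P
        + ∫ ω, (∫ s, G (X s ω) ∂m) ^ 2 ∂P) := by
  have hGsq := (hX.memLp_integral_comp hG m).integrable_sq
  have hFG : MemLp (fun w ↦ F w - G w) 2 ν := hF.sub hG
  have hFGsq := (hX.memLp_integral_comp hFG m).integrable_sq
  rw [← integral_add hFGsq hGsq, ← integral_const_mul]
  refine integral_mono_ae (hX.memLp_integral_comp hF m).integrable_sq
    ((hFGsq.add hGsq).const_mul 2) ?_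
  filter_upwards [hX.integral_sub_comp_ae_eq hF m hG] with ω hω
  refine le_of_eq_of_le ?_ add_sq_le
  rw [hω, sub_add_cancel]

theorem integral_sq_integral_comp :
    ∫ ω, (∫ s, F (X s ω) ∂m) ^ 2 ∂P
      = ∫ z, ∫ ω, F (X z.1 ω) * F (X z.2 ω) ∂P ∂(m.prod m) := by
  rw [integral_integral_swap (f := fun (z : S × S) ω ↦ F (X z.1 ω) * F (X z.2 ω))
    (hX.integrable_mul_comp_uncurry hF m)]
  refine integral_congr_ae (.of_forall fun ω ↦ ?_)
  exact (sq _).trans (integral_prod_mul (fun s ↦ F (X s ω)) fun s ↦ F (X s ω)).symm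

theorem integral_sq_integral_comp_le :
    ∫ ω, (∫ s, F (X s ω) ∂m) ^ 2 ∂P ≤ m.real Set.univ ^ 2 * ∫ w, F w ^ 2 ∂ν := by
  rw [hX.integral_sq_integral_comp hF m]
  calc ∫ z, ∫ ω, F (X z.1 ω) * F (X z.2 ω) ∂P ∂(m.prod m)
      ≤ ∫ _, ∫ w, F w ^ 2 ∂ν ∂(m.prod m) :=
        integral_mono (hX.integrable_mul_comp_uncurry hF m).integral_prod_left
          (integrable_const _) fun z ↦ hX.integral_mul_comp_le hF z.1 z.2
    _ = m.real Set.univ ^ 2 * ∫ w, F w ^ 2 ∂ν := by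
        rw [integral_const, smul_eq_mul, ← Set.univ_prod_univ, measureReal_prod_prod, sq]

end HasMarginal

end Marginal

section Field

variable {d : ℕ} {ι Ω : Type*} [Fintype ι] [MeasurableSpace Ω] {P : Measure Ω}

theorem abs_two_mul_covariance_le [IsFiniteMeasure P] {X Y : Ω → ℝ} (hX : MemLp X 2 P)
    (hY : MemLp Y 2 P) : |2 * covariance X Y P| ≤ variance X P + variance Y P := by
  have hadd := variance_nonneg (X + Y) P
  have hsub := variance_nonneg (X - Y) P
  rw [variance_add hX hY] at hadd
  rw [variance_sub hX hY] at hsub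
  exact abs_le.2 ⟨by linarith, by linarith⟩

open Classical in
theorem integral_hermiteProd_mul_hermiteProd {X Y : ι → Ω → ℝ}
    (hind : iIndepFun (fun j ω ↦ (X j ω, Y j ω)) P)
    (hXY : ∀ j, HasGaussianLaw (fun ω ↦ (X j ω, Y j ω)) P)
    (hX0 : ∀ j, ∫ ω, X j ω ∂P = 0) (hX1 : ∀ j, variance (X j) P = 1)
    (hY0 : ∀ j, ∫ ω, Y j ω ∂P = 0) (hY1 : ∀ j, variance (Y j) P = 1) (u v : ι → ℕ) :
    ∫ ω, hermiteProd u (fun j ↦ X j ω) * hermiteProd v (fun j ↦ Y j ω) ∂P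
      = if u = v then factorialProd u * ∏ j, covariance (X j) (Y j) P ^ u j else 0 := by
  have hcont (j : ι) : Continuous fun z : ℝ × ℝ ↦
      (hermiteReal (u j)).eval z.1 * (hermiteReal (v j)).eval z.2 := by fun_prop
  simp only [hermiteProd_eq_prod_eval, ← Finset.prod_mul_distrib]
  rw [hind.integral_fun_prod_comp
    (f := fun j z ↦ (hermiteReal (u j)).eval z.1 * (hermiteReal (v j)).eval z.2)
    (fun j ↦ (hXY j).aemeasurable) fun j ↦ (hcont j).aestronglyMeasurable]
  simp only [fun j ↦ integral_hermiteReal_mul_hermiteReal (hXY j) (hX0 j) (hX1 j) (hY0 j) (hY1 j)]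
  split_ifs with huv
  · simp [huv, factorialProd, Finset.prod_mul_distrib]
  · obtain ⟨j, hj⟩ := Function.ne_iff.1 huv
    exact Finset.prod_eq_zero (Finset.mem_univ j) (if_neg hj)

variable {η : ι → EuclideanSpace ℝ (Fin d) → Ω → ℝ} {e : ι → ℝ} {L : ι → ℝ → ℝ}

/-- The covariance of `e_v(η(x))` and `e_v(η(y))` divided by `v!`, as a function of `z = (x, y)`. -/
noncomputable def covKernel (P : Measure Ω) (η : ι → EuclideanSpace ℝ (Fin d) → Ω → ℝ) (v : ι → ℕ)
    (z : EuclideanSpace ℝ (Fin d) × EuclideanSpace ℝ (Fin d)) : ℝ :=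
  ∏ j, covariance (η j z.1) (η j z.2) P ^ v j

namespace IsGaussianVectorField

section Law

variable (hη : IsGaussianVectorField P η e L)
include hη

theorem measurable_apply (j : ι) (x : EuclideanSpace ℝ (Fin d)) : Measurable (η j x) :=
  (hη.measurable j).comp measurable_prodMk_left

theorem hasGaussianLaw_prodMk (j : ι) (x y : EuclideanSpace ℝ (Fin d)) :
    HasGaussianLaw (fun ω ↦ (η j x ω, η j y ω)) P :=
  hη.gaussian.hasGaussianLaw_prodMk (s := (j, x)) (t := (j, y))

theorem memLp_two (j : ι) (x : EuclideanSpace ℝ (Fin d)) : MemLp (η j x) 2 P :=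
  (hη.hasGaussianLaw_prodMk j x x).fst.memLp_two

theorem hasMarginal : HasMarginal (fun x ω j ↦ η j x ω) P (stdGaussianMeasure ι) where
  measurable_uncurry := measurable_pi_lambda _ hη.measurable
  map_eq x := by
    have hind : iIndepFun (fun j ω ↦ η j x ω) P :=
      hη.indep.comp (fun _ f ↦ f x) fun _ ↦ measurable_pi_apply x
    rw [hind.map_fun_eq_pi_map fun j ↦ (hη.measurable_apply j x).aemeasurable, stdGaussianMeasure]
    congr 1
    funext j
    rw [(hη.hasGaussianLaw_prodMk j x x).fst.map_eq_gaussianReal, hη.mean_zero, hη.variance_one,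
      Real.toNNReal_one]

open Classical in
theorem integral_hermiteProd_mul_hermiteProd (u v : ι → ℕ) (x y : EuclideanSpace ℝ (Fin d)) :
    ∫ ω, hermiteProd u (fun j ↦ η j x ω) * hermiteProd v (fun j ↦ η j y ω) ∂P
      = if u = v then factorialProd u * covKernel P η u (x, y) else 0 :=
  HermiteReduction.integral_hermiteProd_mul_hermiteProd
    (hη.indep.comp (fun _ f ↦ (f x, f y)) fun _ ↦ by fun_prop)
    (fun j ↦ hη.hasGaussianLaw_prodMk j x y) (fun j ↦ hη.mean_zero j x)
    (fun j ↦ hη.variance_one j x) (fun j ↦ hη.mean_zero j y) (fun j ↦ hη.variance_one j y) u v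

theorem integral_hermitePartialSum_mul_hermitePartialSum (f : (ι → ℝ) → ℝ) (s : Finset (ι → ℕ))
    (x y : EuclideanSpace ℝ (Fin d)) :
    ∫ ω, hermitePartialSum f s (fun j ↦ η j x ω) * hermitePartialSum f s (fun j ↦ η j y ω) ∂P
      = ∑ v ∈ s, hermiteCoeff f v ^ 2 / factorialProd v * covKernel P η v (x, y) := by
  classical
  have hi (c c' : ℝ) (u v : ι → ℕ) : Integrable (fun ω ↦ c * hermiteProd u (fun j ↦ η j x ω) *
      (c' * hermiteProd v fun j ↦ η j y ω)) P :=
    ((hη.hasMarginal.memLp_comp (memLp_hermiteProd u) x).const_mul _).integrable_mul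
      ((hη.hasMarginal.memLp_comp (memLp_hermiteProd v) y).const_mul _)
  simp only [hermitePartialSum, Finset.sum_mul_sum]
  rw [integral_finsetSum _ fun u _ ↦ integrable_finsetSum _ fun v _ ↦ hi _ _ u v]
  refine Finset.sum_congr rfl fun u hu ↦ ?_
  rw [integral_finsetSum _ fun v _ ↦ hi _ _ u v]
  simp only [mul_mul_mul_comm _ (hermiteProd u _), integral_const_mul,
    hη.integral_hermiteProd_mul_hermiteProd, mul_ite, mul_zero, Finset.sum_ite_eq, if_pos hu]
  field_simp [(factorialProd_pos u).ne']

theorem covKernel_eq (v : ι → ℕ) {z : EuclideanSpace ℝ (Fin d) × EuclideanSpace ℝ (Fin d)}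
    (hz : z.1 ≠ z.2) :
    covKernel P η v z = ‖z.1 - z.2‖ ^ (-exponentSum e v) * ∏ j, L j ‖z.1 - z.2‖ ^ v j := by
  have hpos : 0 < ‖z.1 - z.2‖ := norm_sub_pos_iff.2 hz
  simp only [covKernel, hη.covariance_eq _ z.1 z.2 hz, mul_pow, Finset.prod_mul_distrib]
  congr 1
  rw [exponentSum, ← Finset.sum_neg_distrib, Real.rpow_sum_of_pos hpos]
  refine Finset.prod_congr rfl fun j _ ↦ ?_
  rw [← Real.rpow_natCast, ← Real.rpow_mul hpos.le, neg_mul]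

theorem covariance_nonneg (hL : ∀ j t, 0 < t → 0 ≤ L j t) (j : ι)
    (x y : EuclideanSpace ℝ (Fin d)) : 0 ≤ covariance (η j x) (η j y) P := by
  rcases eq_or_ne x y with rfl | hxy
  · rw [covariance_self (hη.measurable_apply j x).aemeasurable]
    exact variance_nonneg _ _
  · rw [hη.covariance_eq j x y hxy]
    exact mul_nonneg (Real.rpow_nonneg (norm_nonneg _) _) (hL j _ (norm_sub_pos_iff.2 hxy))

theorem covKernel_nonneg (hL : ∀ j t, 0 < t → 0 ≤ L j t) (v : ι → ℕ)
    (z : EuclideanSpace ℝ (Fin d) × EuclideanSpace ℝ (Fin d)) : 0 ≤ covKernel P η v z :=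
  Finset.prod_nonneg fun j _ ↦ pow_nonneg (hη.covariance_nonneg hL j _ _) _

end Law

variable [IsProbabilityMeasure P] (hη : IsGaussianVectorField P η e L)
include hη

theorem abs_covariance_le_one (j : ι) (x y : EuclideanSpace ℝ (Fin d)) :
    |covariance (η j x) (η j y) P| ≤ 1 := by
  have h := abs_two_mul_covariance_le (hη.memLp_two j x) (hη.memLp_two j y)
  rw [hη.variance_one, hη.variance_one, abs_mul, abs_two] at h
  linarith

theorem abs_covKernel_le_one (v : ι → ℕ)
    (z : EuclideanSpace ℝ (Fin d) × EuclideanSpace ℝ (Fin d)) : |covKernel P η v z| ≤ 1 := by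
  simp only [covKernel, Finset.abs_prod, abs_pow]
  exact Finset.prod_le_one (fun j _ ↦ by positivity) fun j _ ↦
    pow_le_one₀ (abs_nonneg _) (hη.abs_covariance_le_one j _ _)

theorem covKernel_anti (hL : ∀ j t, 0 < t → 0 ≤ L j t) {u v : ι → ℕ} (huv : u ≤ v)
    (z : EuclideanSpace ℝ (Fin d) × EuclideanSpace ℝ (Fin d)) :
    covKernel P η v z ≤ covKernel P η u z :=
  Finset.prod_le_prod (fun j _ ↦ pow_nonneg (hη.covariance_nonneg hL j _ _) _) fun j _ ↦
    pow_le_pow_of_le_one (hη.covariance_nonneg hL j _ _)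
      ((le_abs_self _).trans (hη.abs_covariance_le_one j _ _)) (huv j)

theorem measurable_covKernel (v : ι → ℕ) : Measurable (covKernel P η v) := by
  have hcov (j : ι) (z : EuclideanSpace ℝ (Fin d) × EuclideanSpace ℝ (Fin d)) :
      covariance (η j z.1) (η j z.2) P = ∫ ω, η j z.1 ω * η j z.2 ω ∂P := by
    rw [covariance_eq_sub (hη.memLp_two j z.1) (hη.memLp_two j z.2), hη.mean_zero, zero_mul,
      sub_zero]
    rfl
  refine Finset.measurable_fun_prod _ fun j _ ↦ Measurable.pow_const ?_ _
  simp only [hcov]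
  have hmul : Measurable fun q : (EuclideanSpace ℝ (Fin d) × EuclideanSpace ℝ (Fin d)) × Ω ↦
      η j q.1.1 q.2 * η j q.1.2 q.2 :=
    ((hη.measurable j).comp ((measurable_fst.comp measurable_fst).prodMk measurable_snd)).mul
      ((hη.measurable j).comp ((measurable_snd.comp measurable_fst).prodMk measurable_snd))
  exact (hmul.stronglyMeasurable.integral_prod_right (ν := P)).measurable

theorem integrable_covKernel (v : ι → ℕ)
    (m : Measure (EuclideanSpace ℝ (Fin d) × EuclideanSpace ℝ (Fin d))) [IsFiniteMeasure m] :
    Integrable (covKernel P η v) m :=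
  (integrable_const (1 : ℝ)).mono' (hη.measurable_covKernel v).aestronglyMeasurable
    (.of_forall (hη.abs_covKernel_le_one v))

variable (m : Measure (EuclideanSpace ℝ (Fin d))) [IsFiniteMeasure m]

theorem integral_sq_integral_hermitePartialSum (f : (ι → ℝ) → ℝ) (s : Finset (ι → ℕ)) :
    ∫ ω, (∫ x, hermitePartialSum f s (fun j ↦ η j x ω) ∂m) ^ 2 ∂P
      = ∑ v ∈ s, hermiteCoeff f v ^ 2 / factorialProd v * ∫ z, covKernel P η v z ∂(m.prod m) := by
  rw [hη.hasMarginal.integral_sq_integral_comp (memLp_hermitePartialSum s) m]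
  simp only [hη.integral_hermitePartialSum_mul_hermitePartialSum]
  rw [integral_finsetSum _ fun v _ ↦ (hη.integrable_covKernel v _).const_mul _]
  simp only [integral_const_mul]

theorem integral_sq_integral_comp_le {f : (ι → ℝ) → ℝ} (hf : MemLp f 2 (stdGaussianMeasure ι))
    {b : ℝ} (hb : ∀ v, hermiteCoeff f v ≠ 0 → ∫ z, covKernel P η v z ∂(m.prod m) ≤ b) :
    ∫ ω, (∫ x, f (fun j ↦ η j x ω) ∂m) ^ 2 ∂P
      ≤ 2 * (b * ∫ w, f w ^ 2 ∂(stdGaussianMeasure ι)) := by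
  have hX := hη.hasMarginal
  have hle (s : Finset (ι → ℕ)) : ∫ ω, (∫ x, f (fun j ↦ η j x ω) ∂m) ^ 2 ∂P
      ≤ 2 * (m.real Set.univ ^ 2 *
          ∫ w, (f w - hermitePartialSum f s w) ^ 2 ∂(stdGaussianMeasure ι)
        + b * ∑ v ∈ s, hermiteCoeff f v ^ 2 / factorialProd v) := by
    have hQ := memLp_hermitePartialSum (f := f) s
    have hR : MemLp (fun w ↦ f w - hermitePartialSum f s w) 2 (stdGaussianMeasure ι) := hf.sub hQ
    refine (hX.integral_sq_integral_comp_le_sub_add hf m hQ).trans ?_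
    rw [hη.integral_sq_integral_hermitePartialSum m, Finset.mul_sum]
    gcongr 2 * (?_ + ∑ v ∈ s, ?_) with v
    · exact hX.integral_sq_integral_comp_le hR m
    · rcases eq_or_ne (hermiteCoeff f v) 0 with hv | hv
      · simp [hv]
      · rw [mul_comm b]
        exact mul_le_mul_of_nonneg_left (hb v hv)
          (div_nonneg (sq_nonneg _) (factorialProd_pos v).le)
  have hlim := ((tendsto_integral_sub_hermitePartialSum_sq hf).const_mul (m.real Set.univ ^ 2)).add
    (Tendsto.const_mul b (hasSum_hermiteCoeff_sq_div hf))
  simpa only [mul_zero, zero_add] using ge_of_tendsto' (hlim.const_mul 2) hle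

end IsGaussianVectorField

end Field

section Kernel

variable {E : Type*} [NormedAddCommGroup E]

/-- The filter of pairs of points whose mutual distance tends to infinity. -/
def farPairs (E : Type*) [NormedAddCommGroup E] : Filter (E × E) :=
  comap (fun z ↦ ‖z.1 - z.2‖) atTop

/-- The set of pairs of points at distance at most `R`; these are the complements of the basic sets
of `farPairs E`. -/
def nearPairs (E : Type*) [NormedAddCommGroup E] (R : ℝ) : Set (E × E) :=
  {z | ‖z.1 - z.2‖ ≤ R}

theorem eventually_farPairs {p : E × E → Prop} :
    (∀ᶠ z in farPairs E, p z) ↔ ∃ R, ∀ z, z ∉ nearPairs E R → p z := by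
  simp [farPairs, nearPairs, (atTop_basis_Ioi.comap _).eventually_iff]

variable [NormedSpace ℝ E] {A : Set E}

theorem exists_norm_sub_le_mul (hA : Bornology.IsBounded A) :
    ∃ D > 0, ∀ r ≥ 0, ∀ x ∈ r • A, ∀ y ∈ r • A, ‖x - y‖ ≤ r * D := by
  obtain ⟨D, hD⟩ := Metric.isBounded_iff.1 hA
  refine ⟨max D 1, by positivity, ?_⟩
  rintro r hr _ ⟨x, hx, rfl⟩ _ ⟨y, hy, rfl⟩
  simp only [← smul_sub, norm_smul, Real.norm_of_nonneg hr, ← dist_eq_norm]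
  exact mul_le_mul_of_nonneg_left ((hD hx hy).trans (le_max_left _ _)) hr

variable [MeasurableSpace E]

/-- The integral of a kernel over `(r • A) × (r • A)`. When `K` is the covariance of a random field,
this is the variance of the integral of the field over `r • A`. -/
noncomputable def kernelIntegral (μ : Measure E) (A : Set E) (K : E × E → ℝ) (r : ℝ) : ℝ :=
  ∫ z, K z ∂((μ.restrict (r • A)).prod (μ.restrict (r • A)))

variable {K K' : E × E → ℝ}

theorem kernelIntegral_nonneg {μ : Measure E} (hK0 : ∀ z, 0 ≤ K z) (r : ℝ) :
    0 ≤ kernelIntegral μ A K r :=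
  integral_nonneg hK0

variable [FiniteDimensional ℝ E] [BorelSpace E] {μ : Measure E} [μ.IsAddHaarMeasure]

theorem measurableSet_nearPairs (R : ℝ) : MeasurableSet (nearPairs E R) :=
  measurableSet_le (by fun_prop) measurable_const

theorem isFiniteMeasure_restrict_smul (hA : Bornology.IsBounded A) (r : ℝ) :
    IsFiniteMeasure (μ.restrict (r • A)) :=
  ⟨by simpa using (hA.smul₀ r).measure_lt_top (μ := μ)⟩

theorem measureReal_smul_of_nonneg {r : ℝ} (hr : 0 ≤ r) :
    μ.real (r • A) = r ^ Module.finrank ℝ E * μ.real A := by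
  rw [Measure.real, Measure.addHaar_smul_of_nonneg _ hr, ENNReal.toReal_mul,
    ENNReal.toReal_ofReal (by positivity), Measure.real]

theorem measureReal_prod_nearPairs_le (μ : Measure E) [μ.IsAddHaarMeasure]
    (hA : Bornology.IsBounded A) (R : ℝ) :
    ((μ.restrict A).prod (μ.restrict A)).real (nearPairs E R)
      ≤ μ.real A * μ.real (Metric.closedBall 0 R) := by
  have hle : ((μ.restrict A).prod (μ.restrict A)) (nearPairs E R)
      ≤ μ A * μ (Metric.closedBall 0 R) := by
    rw [Measure.prod_apply (measurableSet_nearPairs R), ← Measure.restrict_apply_univ A,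
      mul_comm, ← lintegral_const]
    refine lintegral_mono fun x ↦ (Measure.restrict_apply_le _ _).trans ?_
    rw [← Measure.addHaar_closedBall_center μ x R]
    refine measure_mono fun y hy ↦ ?_
    rw [Metric.mem_closedBall, dist_comm, dist_eq_norm]
    exact hy
  rw [Measure.real, Measure.real, Measure.real, ← ENNReal.toReal_mul]
  exact ENNReal.toReal_mono
    (ENNReal.mul_ne_top hA.measure_lt_top.ne Metric.isBounded_closedBall.measure_lt_top.ne) hle

theorem eventually_le_measureReal_prod_compl_nearPairs (hA : Bornology.IsBounded A) (hμA : μ A ≠ 0)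
    (hE : Module.finrank ℝ E ≠ 0) (R : ℝ) :
    ∀ᶠ r : ℝ in atTop, (r ^ Module.finrank ℝ E * μ.real A) ^ 2 / 2
      ≤ ((μ.restrict (r • A)).prod (μ.restrict (r • A))).real (nearPairs E R)ᶜ := by
  have hV : 0 < μ.real A := ENNReal.toReal_pos hμA hA.measure_lt_top.ne
  have hgrow : Tendsto (fun r : ℝ ↦ r ^ Module.finrank ℝ E * μ.real A) atTop atTop :=
    (tendsto_pow_atTop hE).atTop_mul_const hV
  filter_upwards [hgrow.eventually_ge_atTop (2 * μ.real (Metric.closedBall 0 R)),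
    eventually_gt_atTop 0] with r hr hr0
  have := isFiniteMeasure_restrict_smul (μ := μ) hA r
  have hnear := measureReal_prod_nearPairs_le μ (hA.smul₀ r) R
  rw [measureReal_compl (measurableSet_nearPairs R), ← Set.univ_prod_univ, measureReal_prod_prod,
    measureReal_restrict_apply MeasurableSet.univ, Set.univ_inter]
  rw [measureReal_smul_of_nonneg hr0.le] at hnear ⊢
  have : 0 < r ^ Module.finrank ℝ E * μ.real A := by positivity
  nlinarith

theorem div_pow_mul_measureReal_le_kernelIntegral (hA : MeasurableSet A)
    (hAb : Bornology.IsBounded A)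
    (hKi : ∀ m : Measure (E × E), IsFiniteMeasure m → Integrable K m) (hK0 : ∀ z, 0 ≤ K z)
    {n : ℕ} {k ρ R r : ℝ} (hR : ∀ z, z ∉ nearPairs E R → k ≤ ‖z.1 - z.2‖ ^ n * K z)
    (hρ : 0 < ρ) (hdiam : ∀ x ∈ r • A, ∀ y ∈ r • A, ‖x - y‖ ≤ ρ) (hk : 0 ≤ k) :
    k / ρ ^ n * ((μ.restrict (r • A)).prod (μ.restrict (r • A))).real (nearPairs E R)ᶜ
      ≤ kernelIntegral μ A K r := by
  have := isFiniteMeasure_restrict_smul (μ := μ) hAb r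
  set m := (μ.restrict (r • A)).prod (μ.restrict (r • A)) with hm
  have hrA : MeasurableSet (r • A) := hA.const_smul₀ r
  have hmem : ∀ᵐ z ∂m, z ∈ (r • A) ×ˢ (r • A) := by
    rw [hm, Measure.prod_restrict]
    exact ae_restrict_mem (hrA.prod hrA)
  have hsub : (nearPairs E R)ᶜ ≤ᵐ[m] {z | k / ρ ^ n ≤ K z} := by
    filter_upwards [hmem] with z hz hzR
    refine (div_le_iff₀' (by positivity)).2 ((hR z hzR).trans ?_)
    exact mul_le_mul_of_nonneg_right
      (pow_le_pow_left₀ (norm_nonneg _) (hdiam _ hz.1 _ hz.2) n) (hK0 z)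
  calc k / ρ ^ n * m.real (nearPairs E R)ᶜ ≤ k / ρ ^ n * m.real {z | k / ρ ^ n ≤ K z} := by
        refine mul_le_mul_of_nonneg_left ?_ (by positivity)
        exact ENNReal.toReal_mono (measure_ne_top _ _) (measure_mono_ae hsub)
    _ ≤ kernelIntegral μ A K r :=
        mul_meas_ge_le_integral_of_nonneg (.of_forall hK0) (hKi _ inferInstance) _

theorem isLittleO_pow_kernelIntegral (hA : MeasurableSet A) (hAb : Bornology.IsBounded A)
    (hμA : μ A ≠ 0) (hE : Module.finrank ℝ E ≠ 0)
    (hKi : ∀ m : Measure (E × E), IsFiniteMeasure m → Integrable K m) (hK0 : ∀ z, 0 ≤ K z)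
    (hK : Tendsto (fun z ↦ ‖z.1 - z.2‖ ^ Module.finrank ℝ E * K z) (farPairs E) atTop) :
    (fun r : ℝ ↦ r ^ Module.finrank ℝ E) =o[atTop] kernelIntegral μ A K := by
  refine Asymptotics.isLittleO_iff.2 fun c hc ↦ ?_
  obtain ⟨D, hD0, hD⟩ := exists_norm_sub_le_mul hAb
  have hV : 0 < μ.real A := ENNReal.toReal_pos hμA hAb.measure_lt_top.ne
  set n := Module.finrank ℝ E
  set V := μ.real A
  set k : ℝ := 2 * D ^ n / (c * V ^ 2) with hk
  obtain ⟨R, hR⟩ := eventually_farPairs.1 (hK.eventually_ge_atTop k)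
  filter_upwards [eventually_le_measureReal_prod_compl_nearPairs hAb hμA hE R,
    eventually_gt_atTop 0] with r hfar hr
  rw [Real.norm_of_nonneg (by positivity),
    Real.norm_of_nonneg (kernelIntegral_nonneg hK0 r)]
  calc r ^ n = c * (k / (r * D) ^ n * ((r ^ n * V) ^ 2 / 2)) := by
        rw [hk, mul_pow]
        field_simp
    _ ≤ c * (k / (r * D) ^ n *
          ((μ.restrict (r • A)).prod (μ.restrict (r • A))).real (nearPairs E R)ᶜ) := by gcongr
    _ ≤ c * kernelIntegral μ A K r := by
        gcongr
        exact div_pow_mul_measureReal_le_kernelIntegral hA hAb hKi hK0 hR (by positivity)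
          (hD r hr.le) (by positivity)

theorem norm_kernelIntegral_le_add (hA : Bornology.IsBounded A)
    (hKi : ∀ m : Measure (E × E), IsFiniteMeasure m → Integrable K m) (hK0 : ∀ z, 0 ≤ K z)
    {C ε R : ℝ} (hK' : ∀ z, ‖K' z‖ ≤ C) (hε : 0 ≤ ε)
    (hfar : ∀ z, z ∉ nearPairs E R → ‖K' z‖ ≤ ε * K z) {r : ℝ} (hr : 0 ≤ r) :
    ‖kernelIntegral μ A K' r‖ ≤ ε * kernelIntegral μ A K r
      + C * (μ.real A * μ.real (Metric.closedBall 0 R)) * r ^ Module.finrank ℝ E := by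
  have hC : 0 ≤ C := (norm_nonneg _).trans (hK' 0)
  have := isFiniteMeasure_restrict_smul (μ := μ) hA r
  have hnear := measureReal_prod_nearPairs_le μ (hA.smul₀ r) R
  rw [measureReal_smul_of_nonneg hr] at hnear
  set m := (μ.restrict (r • A)).prod (μ.restrict (r • A))
  have hmK : Integrable K m := hKi _ inferInstance
  have hmC : Integrable ((nearPairs E R).indicator fun _ ↦ C) m :=
    (integrable_const _).indicator (measurableSet_nearPairs R)
  calc ‖kernelIntegral μ A K' r‖
      ≤ ∫ z, (ε * K z + (nearPairs E R).indicator (fun _ ↦ C) z) ∂m := by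
        refine norm_integral_le_of_norm_le ((hmK.const_mul ε).add hmC) (.of_forall fun z ↦ ?_)
        by_cases hz : z ∈ nearPairs E R
        · simpa only [Set.indicator_of_mem hz] using
            (hK' z).trans (le_add_of_nonneg_left (mul_nonneg hε (hK0 z)))
        · simpa only [Set.indicator_of_notMem hz, add_zero] using hfar z hz
    _ = ε * kernelIntegral μ A K r + C * m.real (nearPairs E R) := by
        rw [integral_add (hmK.const_mul ε) hmC, integral_const_mul,
          integral_indicator (measurableSet_nearPairs R), setIntegral_const, smul_eq_mul,
          mul_comm C]
        rfl
    _ ≤ _ := by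
        rw [mul_assoc C, mul_right_comm, mul_comm (μ.real A)]
        gcongr

theorem isLittleO_kernelIntegral (hA : Bornology.IsBounded A)
    (hKi : ∀ m : Measure (E × E), IsFiniteMeasure m → Integrable K m) (hK0 : ∀ z, 0 ≤ K z)
    (hpow : (fun r : ℝ ↦ r ^ Module.finrank ℝ E) =o[atTop] kernelIntegral μ A K)
    {C : ℝ} (hK' : ∀ z, ‖K' z‖ ≤ C) (hKK' : K' =o[farPairs E] K) :
    kernelIntegral μ A K' =o[atTop] kernelIntegral μ A K := by
  refine Asymptotics.isLittleO_iff.2 fun ε hε ↦ ?_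
  obtain ⟨R, hR⟩ := eventually_farPairs.1 (Asymptotics.isLittleO_iff.1 hKK' (half_pos hε))
  set B := C * (μ.real A * μ.real (Metric.closedBall 0 R))
  filter_upwards [Asymptotics.isLittleO_iff.1 (hpow.const_mul_left B) (half_pos hε),
    eventually_ge_atTop 0] with r hBr hr
  have hle := norm_kernelIntegral_le_add (μ := μ) hA hKi hK0 hK' (half_pos hε).le
    (fun z hz ↦ (hR z hz).trans_eq (by rw [Real.norm_of_nonneg (hK0 z)])) hr
  rw [Real.norm_of_nonneg (kernelIntegral_nonneg hK0 r)] at hBr ⊢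
  linarith [le_abs_self (B * r ^ Module.finrank ℝ E), Real.norm_eq_abs (B * r ^ Module.finrank ℝ E)]

theorem kernelIntegral_mono (hA : Bornology.IsBounded A)
    (hKi : ∀ m : Measure (E × E), IsFiniteMeasure m → Integrable K m)
    (hKi' : ∀ m : Measure (E × E), IsFiniteMeasure m → Integrable K' m) (hle : ∀ z, K z ≤ K' z)
    (r : ℝ) : kernelIntegral μ A K r ≤ kernelIntegral μ A K' r :=
  have := isFiniteMeasure_restrict_smul (μ := μ) hA r
  integral_mono (hKi _ inferInstance) (hKi' _ inferInstance) hle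

end Kernel

section CovKernel

variable {d : ℕ} {ι Ω : Type*} [Fintype ι] [MeasurableSpace Ω] {P : Measure Ω}
  {η : ι → EuclideanSpace ℝ (Fin d) → Ω → ℝ} {e : ι → ℝ} {L : ι → ℝ → ℝ}

theorem tendsto_norm_sub_farPairs {E : Type*} [NormedAddCommGroup E] :
    Tendsto (fun z : E × E ↦ ‖z.1 - z.2‖) (farPairs E) atTop :=
  tendsto_comap

theorem SlowlyVarying.prod_pow (hL : ∀ j, SlowlyVarying (L j)) (v : ι → ℕ) :
    SlowlyVarying fun t ↦ ∏ j, L j t ^ v j :=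
  SlowlyVarying.prod (L := fun j t ↦ L j t ^ v j) Finset.univ fun j _ ↦ (hL j).pow (v j)

namespace IsGaussianVectorField

variable (hη : IsGaussianVectorField P η e L) (hL : ∀ j, SlowlyVarying (L j)) {u v : ι → ℕ}
include hη hL

theorem tendsto_norm_pow_mul_covKernel (hv : exponentSum e v < d) :
    Tendsto (fun z ↦ ‖z.1 - z.2‖ ^ d * covKernel P η v z) (farPairs _) atTop := by
  refine (((SlowlyVarying.prod_pow hL v).tendsto_rpow_mul_atTop (sub_pos.2 hv)).comp
    tendsto_norm_sub_farPairs).congr' ?_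
  filter_upwards [tendsto_norm_sub_farPairs.eventually_gt_atTop 0] with z hz
  rw [hη.covKernel_eq v (norm_sub_pos_iff.1 hz), Function.comp_apply, sub_eq_add_neg (d : ℝ),
    Real.rpow_add hz, Real.rpow_natCast, mul_assoc]

theorem isLittleO_covKernel (huv : exponentSum e v < exponentSum e u) :
    covKernel P η u =o[farPairs _] covKernel P η v := by
  have hLv := SlowlyVarying.prod_pow hL v
  have hLu := SlowlyVarying.prod_pow hL u
  have hlim := ((hLv.mul hLu.inv).tendsto_rpow_mul_atTop (sub_pos.2 huv)).inv_tendsto_atTop.comp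
    (tendsto_norm_sub_farPairs (E := EuclideanSpace ℝ (Fin d)))
  have hpos := (tendsto_norm_sub_farPairs (E := EuclideanSpace ℝ (Fin d))).eventually_gt_atTop 0
  refine (Asymptotics.isLittleO_iff_tendsto' ?_).2 (hlim.congr' ?_)
  · filter_upwards [hpos] with z hz hvz
    rw [hη.covKernel_eq v (norm_sub_pos_iff.1 hz)] at hvz
    exact absurd hvz (mul_pos (Real.rpow_pos_of_pos hz _) (hLv.pos _ hz)).ne'
  · filter_upwards [hpos] with z hz
    have := (hLu.pos _ hz).ne'
    have := (hLv.pos _ hz).ne'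
    have := (Real.rpow_pos_of_pos hz (exponentSum e u)).ne'
    rw [hη.covKernel_eq v (norm_sub_pos_iff.1 hz), hη.covKernel_eq u (norm_sub_pos_iff.1 hz),
      Function.comp_apply, Pi.inv_apply, Real.rpow_sub hz, Real.rpow_neg hz.le, Real.rpow_neg hz.le]
    field_simp

variable [IsProbabilityMeasure P] {A : Set (EuclideanSpace ℝ (Fin d))}

theorem isLittleO_pow_kernelIntegral_covKernel (hA : MeasurableSet A)
    (hAb : Bornology.IsBounded A) (hA0 : volume A ≠ 0) (hd : d ≠ 0) (hv : exponentSum e v < d) :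
    (fun r : ℝ ↦ r ^ d) =o[atTop] kernelIntegral volume A (covKernel P η v) := by
  simpa only [finrank_euclideanSpace_fin] using isLittleO_pow_kernelIntegral hA hAb hA0
    (by rwa [finrank_euclideanSpace_fin]) (fun m _ ↦ hη.integrable_covKernel v m)
    (hη.covKernel_nonneg (fun j t ht ↦ ((hL j).pos t ht).le) v)
    (by simpa only [finrank_euclideanSpace_fin] using hη.tendsto_norm_pow_mul_covKernel hL hv)

theorem isLittleO_kernelIntegral_covKernel (hA : MeasurableSet A) (hAb : Bornology.IsBounded A)
    (hA0 : volume A ≠ 0) (hd : d ≠ 0) (hv : exponentSum e v < d)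
    (huv : exponentSum e v < exponentSum e u) :
    kernelIntegral volume A (covKernel P η u) =o[atTop]
      kernelIntegral volume A (covKernel P η v) := by
  refine isLittleO_kernelIntegral hAb (fun m _ ↦ hη.integrable_covKernel v m)
    (hη.covKernel_nonneg (fun j t ht ↦ ((hL j).pos t ht).le) v) ?_
    (hη.abs_covKernel_le_one u) (hη.isLittleO_covKernel hL huv)
  simpa only [finrank_euclideanSpace_fin] using
    hη.isLittleO_pow_kernelIntegral_covKernel hL hA hAb hA0 hd hv

-- Uniformity in `u` holds because the multi-indices with `exponentSum e v < exponentSum e u` have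
-- finitely many minimal elements (Dickson's lemma) and the covariance kernels decrease in `u`.
theorem eventually_forall_kernelIntegral_covKernel_le (hA : MeasurableSet A)
    (hAb : Bornology.IsBounded A) (hA0 : volume A ≠ 0) (hd : d ≠ 0) (hv : exponentSum e v < d)
    {ε : ℝ} (hε : 0 < ε) :
    ∀ᶠ r : ℝ in atTop, ∀ u, exponentSum e v < exponentSum e u →
      kernelIntegral volume A (covKernel P η u) r
        ≤ ε * kernelIntegral volume A (covKernel P η v) r := by
  have hL0 (j : ι) (t : ℝ) (ht : 0 < t) : 0 ≤ L j t := ((hL j).pos t ht).le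
  set S : Set (ι → ℕ) := {u | Minimal (fun u ↦ exponentSum e v < exponentSum e u) u}
  have hS : S.Finite := (setOfPred_minimal_antichain _).finite_of_partiallyWellOrderedOn
    (Set.isPWO_of_wellQuasiOrderedLE S)
  have hSle : ∀ᶠ r : ℝ in atTop, ∀ u ∈ S, ‖kernelIntegral volume A (covKernel P η u) r‖
      ≤ ε * ‖kernelIntegral volume A (covKernel P η v) r‖ :=
    hS.eventually_all.2 fun u hu ↦ Asymptotics.isLittleO_iff.1
      (hη.isLittleO_kernelIntegral_covKernel hL hA hAb hA0 hd hv hu.1) hε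
  filter_upwards [hSle] with r hr u hu
  obtain ⟨w, hwu, hw⟩ := exists_minimal_le_of_wellFoundedLT
    (fun u ↦ exponentSum e v < exponentSum e u) u hu
  have hwr := (le_abs_self _).trans (hr w hw)
  rw [Real.norm_of_nonneg (kernelIntegral_nonneg (hη.covKernel_nonneg hL0 v) r)] at hwr
  exact (kernelIntegral_mono hAb (fun m _ ↦ hη.integrable_covKernel u m)
    (fun m _ ↦ hη.integrable_covKernel w m) (hη.covKernel_anti hL0 hwu) r).trans hwr

end IsGaussianVectorField

end CovKernel

section Normalization

theorem norm_inv_norm_smul_sub_le {V : Type*} [NormedAddCommGroup V] [NormedSpace ℝ V] {x y : V}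
    {c : ℝ} (hc : 0 ≤ c) (hxy : ‖x - y‖ ≤ c * ‖y‖) : ‖‖x‖⁻¹ • x - ‖y‖⁻¹ • y‖ ≤ 2 * c := by
  rcases eq_or_ne y 0 with rfl | hy
  · rw [norm_zero, mul_zero, sub_zero] at hxy
    simpa [norm_le_zero_iff.1 hxy] using hc
  have hy0 : 0 < ‖y‖ := norm_pos_iff.2 hy
  have hsplit : ‖x‖⁻¹ • x - ‖y‖⁻¹ • y = ‖y‖⁻¹ • ((x - y) + (‖y‖ - ‖x‖) • ‖x‖⁻¹ • x) := by
    rcases eq_or_ne x 0 with rfl | hx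
    · simp
    · have hx0 := norm_ne_zero_iff.2 hx
      match_scalars <;> field_simp
      ring
  have hunit : ‖‖x‖⁻¹ • x‖ ≤ 1 := by
    rw [norm_smul, norm_inv, norm_norm]
    exact inv_mul_le_one
  have hscal : ‖(‖y‖ - ‖x‖) • ‖x‖⁻¹ • x‖ ≤ ‖x - y‖ := by
    rw [norm_smul, norm_sub_rev x]
    exact (mul_le_of_le_one_right (norm_nonneg _) hunit).trans (abs_norm_sub_norm_le y x)
  rw [hsplit, norm_smul, norm_inv, norm_norm, inv_mul_le_iff₀ hy0]
  linarith [norm_add_le (x - y) ((‖y‖ - ‖x‖) • ‖x‖⁻¹ • x)]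

variable {Ω : Type*} [MeasurableSpace Ω] {P : Measure Ω}

theorem norm_toLp_two_sq {X : Ω → ℝ} (hX : MemLp X 2 P) : ‖hX.toLp X‖ ^ 2 = ∫ ω, X ω ^ 2 ∂P := by
  rw [← real_inner_self_eq_norm_sq, L2.inner_def]
  refine integral_congr_ae (hX.coeFn_toLp.mono fun ω hω ↦ ?_)
  simp [hω, sq]

theorem div_sqrt_variance_eq_smul {X : Ω → ℝ} (hX : MemLp X 2 P) (hX0 : ∫ ω, X ω ∂P = 0) :
    (fun ω ↦ X ω / √(variance X P)) = ‖hX.toLp X‖⁻¹ • X := by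
  have hsd : √(variance X P) = ‖hX.toLp X‖ := by
    rw [variance_of_integral_eq_zero hX.aestronglyMeasurable.aemeasurable hX0,
      ← norm_toLp_two_sq hX, Real.sqrt_sq (norm_nonneg _)]
  funext ω
  rw [hsd, div_eq_inv_mul, Pi.smul_apply, smul_eq_mul]

theorem tendstoInMeasure_sub_of_tendsto_norm_toLp_sub {α : Type*} {l : Filter α} {X Y : α → Ω → ℝ}
    (hX : ∀ r, MemLp (X r) 2 P) (hY : ∀ r, MemLp (Y r) 2 P)
    (h : Tendsto (fun r ↦ ‖(hX r).toLp (X r) - (hY r).toLp (Y r)‖) l (𝓝 0)) :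
    TendstoInMeasure P (X - Y) l 0 := by
  refine tendstoInMeasure_of_tendsto_eLpNorm two_ne_zero
    (fun r ↦ ((hX r).sub (hY r)).aestronglyMeasurable) aestronglyMeasurable_zero ?_
  have hlim := ENNReal.tendsto_ofReal h
  rw [ENNReal.ofReal_zero] at hlim
  refine hlim.congr fun r ↦ ?_
  rw [← MemLp.toLp_sub, ofReal_norm, Lp.enorm_toLp, sub_zero, Pi.sub_apply]

variable [IsProbabilityMeasure P]

theorem normalizedLimit_iff_of_isLittleO {K S : ℝ → Ω → ℝ} (hK : ∀ r, MemLp (K r) 2 P)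
    (hS : ∀ r, MemLp (S r) 2 P) (hK0 : ∀ r, ∫ ω, K r ω ∂P = 0) (hS0 : ∀ r, ∫ ω, S r ω ∂P = 0)
    (h : (fun r ↦ ∫ ω, (K r ω - S r ω) ^ 2 ∂P) =o[atTop] fun r ↦ ∫ ω, S r ω ^ 2 ∂P)
    (μ : Measure ℝ) [IsProbabilityMeasure μ] :
    NormalizedLimit P K μ ↔ NormalizedLimit P S μ := by
  have ho : (fun r ↦ ‖(hK r).toLp - (hS r).toLp‖) =o[atTop] fun r ↦ ‖(hS r).toLp‖ := by
    refine Asymptotics.IsLittleO.of_pow (n := 2) ?_ two_ne_zero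
    simpa only [Pi.pow_def, ← MemLp.toLp_sub, norm_toLp_two_sq, Pi.sub_apply] using h
  have hKn := fun r ↦ (hK r).const_smul ‖(hK r).toLp‖⁻¹
  have hSn := fun r ↦ (hS r).const_smul ‖(hS r).toLp‖⁻¹
  have hlim : Tendsto (fun r ↦ ‖(hKn r).toLp - (hSn r).toLp‖) atTop (𝓝 0) := by
    refine (Asymptotics.isLittleO_one_iff ℝ).1 (Asymptotics.isLittleO_iff.2 fun c hc ↦ ?_)
    filter_upwards [Asymptotics.isLittleO_iff.1 ho (half_pos hc)] with r hr
    rw [norm_norm, norm_norm] at hr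
    rw [norm_norm, norm_one, mul_one, (hK r).toLp_const_smul, (hS r).toLp_const_smul]
    linarith [norm_inv_norm_smul_sub_le (half_pos hc).le hr]
  have hKeq (r : ℝ) := div_sqrt_variance_eq_smul (hK r) (hK0 r)
  have hSeq (r : ℝ) := div_sqrt_variance_eq_smul (hS r) (hS0 r)
  rw [NormalizedLimit, NormalizedLimit, funext hKeq, funext hSeq]
  have hlim' := hlim.congr fun r ↦ norm_sub_rev _ _
  exact ⟨fun hX ↦ tendstoInDistribution_of_tendstoInMeasure_sub _ _ hX
      (tendstoInMeasure_sub_of_tendsto_norm_toLp_sub hSn hKn hlim')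
      fun r ↦ (hSn r).aestronglyMeasurable.aemeasurable,
    fun hX ↦ tendstoInDistribution_of_tendstoInMeasure_sub _ _ hX
      (tendstoInMeasure_sub_of_tendsto_norm_toLp_sub hKn hSn hlim)
      fun r ↦ (hKn r).aestronglyMeasurable.aemeasurable⟩

end Normalization

section CriticalIndices

variable {d : ℕ} {ι Ω : Type*} [Fintype ι] {e : ι → ℝ} {G : (ι → ℝ) → ℝ} {κ : ℕ} {γ : ℝ}

theorem exponentSum_nonneg (he : ∀ j, 0 ≤ e j) (v : ι → ℕ) : 0 ≤ exponentSum e v :=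
  Finset.sum_nonneg fun j _ ↦ mul_nonneg (he j) (Nat.cast_nonneg _)

theorem mem_Nplus_of_hermiteCoeff_ne_zero (hκ : IsHermiteRank G κ) (hG0 : hermiteCoeff G 0 = 0)
    {v : ι → ℕ} (hv : hermiteCoeff G v ≠ 0) : v ∈ Nplus G κ := by
  refine ⟨?_, hv⟩
  by_contra! hlt
  refine hv (hκ.coeff_eq_zero v ?_ hlt)
  by_contra! h0
  have hv0 : v = 0 := by simpa [funext_iff] using h0
  exact hv (hv0 ▸ hG0)

open Classical in
/-- The set `⋃_l Ñ*_l` of all the multi-indices occurring in `∑_l K̃*_{r,l}`. -/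
noncomputable def criticalIndices (G : (ι → ℝ) → ℝ) (κ : ℕ) (e : ι → ℝ) (γ : ℝ)
    (he : ∀ j, 0 < e j) : Finset (ι → ℕ) :=
  (Lplus_finite G κ e γ he).toFinset.biUnion (Nstar G κ e γ)

theorem mem_criticalIndices (he : ∀ j, 0 < e j) {v : ι → ℕ} :
    v ∈ criticalIndices G κ e γ he ↔ v ∈ Nplus G κ ∧ exponentSum e v = γ := by
  simp only [criticalIndices, Finset.mem_biUnion, Set.Finite.mem_toFinset, mem_Nstar]
  exact ⟨fun ⟨_, _, _, h⟩ ↦ h,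
    fun h ↦ ⟨∑ j, v j, ⟨h.1.1, v, mem_Nstar.2 ⟨rfl, h⟩⟩, rfl, h⟩⟩

theorem KstarSum_eq_sum_criticalIndices (Δ : Set (EuclideanSpace ℝ (Fin d)))
    (η : ι → EuclideanSpace ℝ (Fin d) → Ω → ℝ) (he : ∀ j, 0 < e j) (r : ℝ) (ω : Ω) :
    KstarSum Δ η G κ e γ r ω = ∑ v ∈ criticalIndices G κ e γ he,
      hermiteCoeff G v / factorialProd v * windowIntegral Δ η (hermiteProd v) r ω := by
  classical
  rw [KstarSum, finsum_mem_eq_finite_toFinset_sum _ (Lplus_finite G κ e γ he), criticalIndices,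
    Finset.sum_biUnion]
  · rfl
  · intro l _ l' _ hl
    refine Finset.disjoint_left.2 fun v hv hv' ↦ hl ?_
    rw [← (mem_Nstar.1 hv).1, (mem_Nstar.1 hv').1]

end CriticalIndices

section Reduction

variable {d : ℕ} {ι Ω : Type*} [Fintype ι] [MeasurableSpace Ω] {P : Measure Ω}
  [IsProbabilityMeasure P] {η : ι → EuclideanSpace ℝ (Fin d) → Ω → ℝ} {e : ι → ℝ}
  {L : ι → ℝ → ℝ} {Δ : Set (EuclideanSpace ℝ (Fin d))} {f : (ι → ℝ) → ℝ}

theorem normalizedLimit_congr {X Y : ℝ → Ω → ℝ} (h : ∀ r, X r =ᵐ[P] Y r) (μ : Measure ℝ)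
    [IsProbabilityMeasure μ] : NormalizedLimit P X μ ↔ NormalizedLimit P Y μ := by
  have hn (r : ℝ) : (fun ω ↦ X r ω / √(variance (X r) P))
      =ᵐ[P] fun ω ↦ Y r ω / √(variance (Y r) P) := by
    filter_upwards [h r] with ω hω
    rw [hω, variance_congr (h r)]
  exact ⟨.congr hn .rfl, .congr (fun r ↦ (hn r).symm) .rfl⟩

theorem hermiteCoeff_zero_right (f : (ι → ℝ) → ℝ) :
    hermiteCoeff f 0 = ∫ w, f w ∂(stdGaussianMeasure ι) := by
  simp only [hermiteCoeff, hermiteProd_zero, Pi.one_apply, mul_one]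

namespace IsGaussianVectorField

variable (hη : IsGaussianVectorField P η e L) (hΔ : Bornology.IsBounded Δ)
  (hf : MemLp f 2 (stdGaussianMeasure ι))
include hη hΔ

section Moments

include hf

theorem memLp_windowIntegral (r : ℝ) : MemLp (windowIntegral Δ η f r) 2 P := by
  have := isFiniteMeasure_restrict_smul (μ := volume) hΔ r
  exact hη.hasMarginal.memLp_integral_comp hf _

theorem integral_windowIntegral (r : ℝ) :
    ∫ ω, windowIntegral Δ η f r ω ∂P = volume.real (r • Δ) * hermiteCoeff f 0 := by
  have := isFiniteMeasure_restrict_smul (μ := volume) hΔ r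
  rw [hermiteCoeff_zero_right, ← measureReal_restrict_apply_univ]
  exact hη.hasMarginal.integral_integral_comp hf _

theorem windowIntegral_sub_ae_eq {g : (ι → ℝ) → ℝ} (hg : MemLp g 2 (stdGaussianMeasure ι))
    (r : ℝ) : windowIntegral Δ η (fun w ↦ f w - g w) r
      =ᵐ[P] fun ω ↦ windowIntegral Δ η f r ω - windowIntegral Δ η g r ω := by
  have := isFiniteMeasure_restrict_smul (μ := volume) hΔ r
  exact hη.hasMarginal.integral_sub_comp_ae_eq hf _ hg

end Moments

theorem windowIntegral_hermitePartialSum_ae_eq (s : Finset (ι → ℕ)) (r : ℝ) :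
    windowIntegral Δ η (hermitePartialSum f s) r =ᵐ[P] fun ω ↦
      ∑ v ∈ s, hermiteCoeff f v / factorialProd v * windowIntegral Δ η (hermiteProd v) r ω := by
  have := isFiniteMeasure_restrict_smul (μ := volume) hΔ r
  filter_upwards [(Finset.eventually_all s).2 fun v _ ↦
    hη.hasMarginal.ae_integrable_comp (memLp_hermiteProd v) (volume.restrict (r • Δ))] with ω hω
  simp only [windowIntegral, hermitePartialSum]
  rw [integral_finsetSum _ fun v hv ↦ (hω v hv).const_mul _]
  simp only [integral_const_mul]

theorem isBigO_kernelIntegral_windowIntegral_hermitePartialSum (hL : ∀ j t, 0 < t → 0 ≤ L j t)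
    {v : ι → ℕ} {s : Finset (ι → ℕ)} (hvs : v ∈ s) (hv : hermiteCoeff f v ≠ 0) :
    kernelIntegral volume Δ (covKernel P η v) =O[atTop]
      fun r ↦ ∫ ω, windowIntegral Δ η (hermitePartialSum f s) r ω ^ 2 ∂P := by
  have hnonneg (u : ι → ℕ) (r : ℝ) : 0 ≤ kernelIntegral volume Δ (covKernel P η u) r :=
    kernelIntegral_nonneg (hη.covKernel_nonneg hL u) r
  have hc : 0 < hermiteCoeff f v ^ 2 / factorialProd v :=
    div_pos (sq_pos_of_ne_zero hv) (factorialProd_pos v)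
  refine .of_bound (hermiteCoeff f v ^ 2 / factorialProd v)⁻¹ (.of_forall fun r ↦ ?_)
  have := isFiniteMeasure_restrict_smul (μ := volume) hΔ r
  have hsq : ∫ ω, windowIntegral Δ η (hermitePartialSum f s) r ω ^ 2 ∂P
      = ∑ u ∈ s, hermiteCoeff f u ^ 2 / factorialProd u *
        kernelIntegral volume Δ (covKernel P η u) r :=
    hη.integral_sq_integral_hermitePartialSum _ f s
  rw [Real.norm_of_nonneg (hnonneg v r),
    Real.norm_of_nonneg (integral_nonneg fun ω ↦ sq_nonneg _), le_inv_mul_iff₀ hc, hsq]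
  exact Finset.single_le_sum (f := fun u ↦ hermiteCoeff f u ^ 2 / factorialProd u *
    kernelIntegral volume Δ (covKernel P η u) r) (fun u _ ↦ mul_nonneg
      (div_nonneg (sq_nonneg _) (factorialProd_pos u).le) (hnonneg u r)) hvs

section LeadingTerms

variable (hL : ∀ j, SlowlyVarying (L j)) (hΔm : MeasurableSet Δ) (hΔ0 : volume Δ ≠ 0)
  (hd : d ≠ 0) {v₀ : ι → ℕ} (hv₀ : exponentSum e v₀ < d)
include hf hL hΔm hΔ0 hd hv₀

theorem isLittleO_windowIntegral_kernelIntegral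
    (h : ∀ v, hermiteCoeff f v ≠ 0 → exponentSum e v₀ < exponentSum e v) :
    (fun r ↦ ∫ ω, windowIntegral Δ η f r ω ^ 2 ∂P) =o[atTop]
      kernelIntegral volume Δ (covKernel P η v₀) := by
  set I := ∫ w, f w ^ 2 ∂(stdGaussianMeasure ι)
  have hI : 0 ≤ I := integral_nonneg fun w ↦ sq_nonneg _
  refine Asymptotics.isLittleO_iff.2 fun c hc ↦ ?_
  have hε : 0 < c / (2 * (I + 1)) := by positivity
  filter_upwards [hη.eventually_forall_kernelIntegral_covKernel_le hL hΔm hΔ hΔ0 hd hv₀ hε]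
    with r hr
  have := isFiniteMeasure_restrict_smul (μ := volume) hΔ r
  have hk : 0 ≤ kernelIntegral volume Δ (covKernel P η v₀) r :=
    kernelIntegral_nonneg (hη.covKernel_nonneg (fun j t ht ↦ ((hL j).pos t ht).le) v₀) r
  rw [Real.norm_of_nonneg (integral_nonneg fun ω ↦ sq_nonneg _), Real.norm_of_nonneg hk]
  calc ∫ ω, windowIntegral Δ η f r ω ^ 2 ∂P
      ≤ 2 * (c / (2 * (I + 1)) * kernelIntegral volume Δ (covKernel P η v₀) r * I) :=
        hη.integral_sq_integral_comp_le _ hf fun v hv ↦ hr v (h v hv)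
    _ = I / (I + 1) * (c * kernelIntegral volume Δ (covKernel P η v₀) r) := by field_simp
    _ ≤ c * kernelIntegral volume Δ (covKernel P η v₀) r :=
        mul_le_of_le_one_left (mul_nonneg hc.le hk) (div_le_one_of_le₀ (by linarith) (by linarith))

theorem normalizedLimit_windowIntegral_iff_hermitePartialSum (hf0 : hermiteCoeff f 0 = 0)
    {s : Finset (ι → ℕ)} (hv₀s : v₀ ∈ s) (hfv₀ : hermiteCoeff f v₀ ≠ 0)
    (hs : ∀ v ∉ s, hermiteCoeff f v ≠ 0 → exponentSum e v₀ < exponentSum e v)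
    (μ : Measure ℝ) [IsProbabilityMeasure μ] :
    NormalizedLimit P (windowIntegral Δ η f) μ ↔
      NormalizedLimit P (windowIntegral Δ η (hermitePartialSum f s)) μ := by
  classical
  have hQ := memLp_hermitePartialSum (f := f) s
  have hR : MemLp (fun w ↦ f w - hermitePartialSum f s w) 2 (stdGaussianMeasure ι) := hf.sub hQ
  have hlead (v : ι → ℕ) (hv : hermiteCoeff (fun w ↦ f w - hermitePartialSum f s w) v ≠ 0) :
      exponentSum e v₀ < exponentSum e v := by
    rw [hermiteCoeff_sub_hermitePartialSum hf, ne_eq, ite_eq_left_iff, Classical.not_imp] at hv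
    exact hs v hv.1 hv.2
  refine normalizedLimit_iff_of_isLittleO (hη.memLp_windowIntegral hΔ hf)
    (hη.memLp_windowIntegral hΔ hQ) (fun r ↦ ?_) (fun r ↦ ?_) ?_ μ
  · rw [hη.integral_windowIntegral hΔ hf, hf0, mul_zero]
  · rw [hη.integral_windowIntegral hΔ hQ, hermiteCoeff_hermitePartialSum, hf0, ite_self, mul_zero]
  · refine ((hη.isLittleO_windowIntegral_kernelIntegral hΔ hR hL hΔm hΔ0 hd hv₀ hlead).trans_isBigO
      (hη.isBigO_kernelIntegral_windowIntegral_hermitePartialSum hΔ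
        (fun j t ht ↦ ((hL j).pos t ht).le) hv₀s hfv₀)).congr_left fun r ↦ integral_congr_ae ?_
    filter_upwards [hη.windowIntegral_sub_ae_eq hΔ hf hQ r] with ω hω
    rw [hω]

end LeadingTerms

end IsGaussianVectorField

end Reduction

end HermiteReduction

open HermiteReduction in
theorem theorem3_general {d : ℕ} {ι Ω : Type*} [Fintype ι] [MeasurableSpace Ω]
    (P : Measure Ω) [IsProbabilityMeasure P]
    (Δ : Set (EuclideanSpace ℝ (Fin d))) (hΔm : MeasurableSet Δ) (hΔ : Bornology.IsBounded Δ)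
    (hΔ0 : volume Δ ≠ 0)
    (e : ι → ℝ) (he : ∀ j, 0 < e j)
    (L : ι → ℝ → ℝ) (hL : ∀ j, SlowlyVarying (L j))
    (η : ι → EuclideanSpace ℝ (Fin d) → Ω → ℝ)
    (hη : IsGaussianVectorField P η e L)
    (G : (ι → ℝ) → ℝ) (hG : MemLp G 2 (stdGaussianMeasure ι))
    (hG_mean : hermiteCoeff G 0 = 0)
    (κ : ℕ) (hκ : IsHermiteRank G κ)
    (γ : ℝ) (hγ : IsLeast (exponentSum e '' Nplus G κ) γ)
    (hγd : γ < d) (μ : Measure ℝ) [IsProbabilityMeasure μ] :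
    NormalizedLimit P (windowIntegral Δ η G) μ ↔
      NormalizedLimit P (KstarSum Δ η G κ e γ) μ := by
  obtain ⟨⟨v₀, hv₀, rfl⟩, hmin⟩ := hγ
  have hd : d ≠ 0 := Nat.cast_ne_zero.1
    ((exponentSum_nonneg (fun j ↦ (he j).le) v₀).trans_lt hγd).ne'
  set s := criticalIndices G κ e (exponentSum e v₀) he
  have hlead (v : ι → ℕ) (hvs : v ∉ s) (hv : hermiteCoeff G v ≠ 0) :
      exponentSum e v₀ < exponentSum e v := by
    have hvN := mem_Nplus_of_hermiteCoeff_ne_zero hκ hG_mean hv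
    exact (hmin ⟨v, hvN, rfl⟩).lt_of_ne'
      fun h ↦ hvs ((mem_criticalIndices he).2 ⟨hvN, h⟩)
  have hsum (r : ℝ) : windowIntegral Δ η (hermitePartialSum G s) r =ᵐ[P]
      KstarSum Δ η G κ e (exponentSum e v₀) r :=
    (hη.windowIntegral_hermitePartialSum_ae_eq hΔ s r).trans <| .of_forall fun ω ↦
      (KstarSum_eq_sum_criticalIndices Δ η he r ω).symm
  exact (hη.normalizedLimit_windowIntegral_iff_hermitePartialSum hΔ hG hL hΔm hΔ0 hd hγd hG_mean
    ((mem_criticalIndices he).2 ⟨hv₀, rfl⟩) hv₀.2 hlead μ).trans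
    (normalizedLimit_congr hsum μ)

theorem theorem3 {d m n : ℕ} {Ω : Type*} [MeasurableSpace Ω]
    (P : MeasureTheory.Measure Ω) [MeasureTheory.IsProbabilityMeasure P]
    (Δ : Set (EuclideanSpace ℝ (Fin d))) (hΔ : HermiteReduction.IsWindow Δ)
    (β : Fin m → ℝ) (hβ : ∀ i, (d : ℝ) < β i)
    (α : Fin n → ℝ) (hα_pos : ∀ j, 0 < α j) (hα : ∀ j, α j < (d : ℝ))
    (L : Fin m ⊕ Fin n → ℝ → ℝ) (hL : ∀ j, HermiteReduction.SlowlyVarying (L j))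
    (η : Fin m ⊕ Fin n → EuclideanSpace ℝ (Fin d) → Ω → ℝ)
    (hη : HermiteReduction.IsGaussianVectorField P η (Sum.elim β α) L)
    (G : (Fin m ⊕ Fin n → ℝ) → ℝ)
    (hG : MeasureTheory.MemLp G 2 (HermiteReduction.stdGaussianMeasure (Fin m ⊕ Fin n)))
    (hG_mean : HermiteReduction.hermiteCoeff G 0 = 0)
    (κ : ℕ) (hκ : HermiteReduction.IsHermiteRank G κ)
    (γ : ℝ)
    (hγ : IsLeast (HermiteReduction.exponentSum (Sum.elim β α) '' HermiteReduction.Nplus G κ) γ)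
    (hγd : γ < (d : ℝ)) :
    ∀ (μ : MeasureTheory.Measure ℝ) [MeasureTheory.IsProbabilityMeasure μ],
      HermiteReduction.NormalizedLimit P (HermiteReduction.windowIntegral Δ η G) μ ↔
        HermiteReduction.NormalizedLimit P
          (HermiteReduction.KstarSum Δ η G κ (Sum.elim β α) γ) μ := by
  have he : ∀ j, 0 < Sum.elim β α j :=
    Sum.rec (fun i ↦ (Nat.cast_nonneg d).trans_lt (hβ i)) hα_pos
  exact fun μ _ ↦ theorem3_general P Δ hΔ.isCompact.measurableSet hΔ.isCompact.isBounded
    hΔ.volume_pos.ne' _ he L hL η hη G hG hG_mean κ hκ γ hγ hγd μ
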